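/- Let $1\le k\le n-1$. Let $[x,y]=-x_1y_1-\dots-x_ny_n+x_{n+1}y_{n+1}$ on $\mathbb R^{n+1}$, let $\mathbb H^n=\{x: [x,x]=1,\ x_{n+1}>0\}$ be the $n$-dimensional real hyperbolic space with its invariant measure $dx=\sinh^{n-1}r\,d\theta\,dr$ in the coordinates $x=\theta\sinh r+e_{n+1}\cosh r$ ($\theta\in S^{n-1}$, $r>0$), and write $x'=(x_1,\dots,x_{n-k})$. For $v\in S^{n-k-1}\subset\mathbb R^{n-k}=\mathbb Re_1\oplus\dots\oplus\mathbb Re_{n-k}$ let $\mathbb R^{k+2}_v=\mathbb Rv\oplus\mathbb Re_{n-k+1}\oplus\dots\oplus\mathbb Re_{n+1}$, $\mathbb H^{k+1}_v=\mathbb H^n\cap\mathbb R^{k+2}_v$, and $\overset{*}{\mathbb H}{}^{k+1}_v=\{w\in\mathbb R^{k+2}_v:[w,w]=-1\}$. Equip $\tilde{\mathbb H}_n=\{(v,w): v\in S^{n-k-1},\ w\in\overset{*}{\mathbb H}{}^{k+1}_v\}$ with the product measure $dv\,dw$, where $dv$ is the surface measure on $S^{n-k-1}$ (counting measure if $k=n-1$)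 and $dw$ is the canonical measure $\cosh^k\rho\,d\sigma\,d\rho$ of the one-sheeted hyperboloid, with $w=\sigma\cosh\rho+e_{n+1}\sinh\rho$, $\rho\in\mathbb R$, $\sigma$ in the unit sphere $S^k$ of $\mathbb Rv\oplus\mathbb Re_{n-k+1}\oplus\dots\oplus\mathbb Re_n$. For a measurable function $f$ on $\mathbb H^n$ the restricted totally geodesic Radon transform is $$(\tilde{\mathcal H}_kf)(v,w)=\int_{\{x\in\mathbb H^{k+1}_v:\,[x,w]=0\}}f(x)\,d_{v,w}x,$$ where $d_{v,w}x$ is the image of the canonical invariant measure on $\mathbb H^k=\mathbb H^n\cap(\mathbb Re_{n-k+1}\oplus\dots\oplus\mathbb Re_{n+1})$ under a pseudo-rotation in $SO_0(n,1)$ that takes $\mathbb H^k$ to the $k$-geodesic $\{x\in\mathbb H^{k+1}_v:[x,w]=0\}$. **Theorem.** If $$\int_{\mathbb H^n}|f(x)|^p\,\frac{dx}{|x'|^{n-k-1}}<\infty,\qquad 1\le p<\frac{k}{k-1}$$ (for $k=1$ the condition on $p$ reads $1\le p<\infty$), then the integral $(\tilde{\mathcal H}_kf)(v,w)$ is finite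 (absolutely convergent) for almost all $(v,w)\in\tilde{\mathbb H}_n$. -/

import Mathlib

open MeasureTheory Set
open scoped ENNReal

noncomputable section

namespace HypRadon

/-! ### Pseudo-Euclidean space and hyperbolic space -/

/-- The pseudo-Euclidean space `𝔼^{n,1} ≅ ℝ^{n+1}`. A point is written as a pair: its first `n`
coordinates `(x₁, …, xₙ)` and its last coordinate `x_{n+1}`. -/
abbrev PseudoE (n : ℕ) : Type := EuclideanSpace ℝ (Fin n) × ℝ

/-- The bilinear form `[x, y] = -x₁y₁ - ⋯ - xₙyₙ + x_{n+1}y_{n+1}`. -/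
def form {n : ℕ} (x y : PseudoE n) : ℝ := -(∑ i, x.1 i * y.1 i) + x.2 * y.2

/-- The hyperbolic space `ℍⁿ`: the upper sheet of the two-sheeted hyperboloid. -/
def hyp (n : ℕ) : Set (PseudoE n) := {x | form x x = 1 ∧ 0 < x.2}

/-- The one-sheeted hyperboloid in `𝔼^{n,1}`. -/
def oneSheet (n : ℕ) : Set (PseudoE n) := {y | form y y = -1}

/-- The unit sphere `S^{n-1}` of `ℝⁿ`. -/
abbrev USphere (n : ℕ) : Type := Metric.sphere (0 : EuclideanSpace ℝ (Fin n)) 1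

/-- The (non-normalized) surface measure on `S^{n-1}`; it is the counting measure for `n = 1`. -/
def sphereMeasure (n : ℕ) : Measure (USphere n) :=
  (volume : Measure (EuclideanSpace ℝ (Fin n))).toSphere

/-- The invariant measure `dx = sinh^{n-1} r dθ dr` on `ℍⁿ` (`n ≥ 1`), where
`x = θ sinh r + e_{n+1} cosh r`, as a measure on `𝔼^{n,1}` carried by `ℍⁿ`. -/
def hypMeasure (n : ℕ) : Measure (PseudoE n) :=
  Measure.map
    (fun q : USphere n × ℝ => (Real.sinh q.2 • (q.1 : EuclideanSpace ℝ (Fin n)), Real.cosh q.2))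
    ((sphereMeasure n).prod
      ((volume.restrict (Ioi (0 : ℝ))).withDensity
        fun r => ENNReal.ofReal (Real.sinh r ^ (n - 1))))

/-- The invariant measure `dy = cosh^{n-1} ρ dσ dρ` on the one-sheeted hyperboloid (`n ≥ 1`), where
`y = σ cosh ρ + e_{n+1} sinh ρ`, `ρ ∈ ℝ`, as a measure on `𝔼^{n,1}` carried by it. -/
def oneSheetMeasure (n : ℕ) : Measure (PseudoE n) :=
  Measure.map
    (fun q : USphere n × ℝ => (Real.cosh q.2 • (q.1 : EuclideanSpace ℝ (Fin n)), Real.sinh q.2))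
    ((sphereMeasure n).prod
      ((volume : Measure ℝ).withDensity fun ρ => ENNReal.ofReal (Real.cosh ρ ^ (n - 1))))

/-- The connected group `SO₀(n, 1)` of pseudo-rotations: the linear maps that preserve the form,
have determinant one, and preserve the upper sheet of the hyperboloid. -/
def IsPseudoRotation {n : ℕ} (r : PseudoE n →ₗ[ℝ] PseudoE n) : Prop :=
  (∀ x y, form (r x) (r y) = form x y) ∧ LinearMap.det r = 1 ∧ 0 < (r (0, 1)).2

/-! ### The splitting `𝔼^{n,1} = ℝ^m × 𝔼^{k,1}`, where `n = m + k`, that is, `m = n - k` -/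

/-- The vector of `ℝ^{m+k}` with first `m` coordinates `a` and last `k` coordinates `b`. -/
def join {m k : ℕ} (a : EuclideanSpace ℝ (Fin m)) (b : EuclideanSpace ℝ (Fin k)) :
    EuclideanSpace ℝ (Fin (m + k)) :=
  WithLp.toLp 2 (Fin.append a.ofLp b.ofLp)

/-- `x' = (x₁, …, x_{n-k})`. -/
def headPart (m k : ℕ) (x : PseudoE (m + k)) : EuclideanSpace ℝ (Fin m) :=
  WithLp.toLp 2 fun i => x.1 (Fin.castAdd k i)

/-- The inclusion of `𝔼^{k,1} = ℝ e_{n-k+1} ⊕ ⋯ ⊕ ℝ e_{n+1}` into `𝔼^{n,1}`. -/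
def tailIncl (m k : ℕ) (z : PseudoE k) : PseudoE (m + k) := (join 0 z.1, z.2)

/-- For `v ∈ S^{n-k-1}`, the isometric embedding
`η ↦ η_{n-k} v + η_{n-k+1} e_{n-k+1} + ⋯ + η_{n+1} e_{n+1}` into `𝔼^{n,1}` of
`𝔼^{k+1,1}`, whose coordinates are numbered from `n-k` to `n+1`. -/
def sliceIncl (m k : ℕ) (v : EuclideanSpace ℝ (Fin m)) (η : PseudoE (k + 1)) : PseudoE (m + k) :=
  (join (η.1 0 • v) (WithLp.toLp 2 fun i : Fin k => η.1 i.succ), η.2)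

/-- `ℝ_v^{k+2} = ℝ v ⊕ ℝ^{k+1}`. -/
def sliceSpace (m k : ℕ) (v : EuclideanSpace ℝ (Fin m)) : Set (PseudoE (m + k)) :=
  {x | ∃ (s : ℝ) (z : PseudoE k), x = (join (s • v) 0, 0) + tailIncl m k z}

/-- The `k`-geodesic `ξ(v, w) = {x ∈ ℍ_v^{k+1} : [x, w] = 0}`, where
`ℍ_v^{k+1} = ℍⁿ ∩ ℝ_v^{k+2}`. -/
def geodesic (m k : ℕ) (v : EuclideanSpace ℝ (Fin m)) (w : PseudoE (m + k)) :
    Set (PseudoE (m + k)) :=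
  {x | x ∈ hyp (m + k) ∩ sliceSpace m k v ∧ form x w = 0}

/-- The parameter space `{(v, w) : v ∈ S^{n-k-1}, w ∈ *ℍ_v^{k+1}}` of the admissible complex, where
`*ℍ_v^{k+1}` is the part in `ℝ_v^{k+2}` of the one-sheeted hyperboloid. -/
def complex (m k : ℕ) : Set (USphere m × PseudoE (m + k)) :=
  {q | q.2 ∈ oneSheet (m + k) ∩ sliceSpace m k q.1}

/-- The product measure `dv dw` on the parameter space (as a measure carried by it): `dv` is the
surface measure of `S^{n-k-1}`, and `dw` on `*ℍ_v^{k+1}` is the canonical measure of the one-sheeted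
hyperboloid in `𝔼^{k+1,1}`, transported by the isometry `sliceIncl m k v`. -/
def complexMeasure (m k : ℕ) : Measure (USphere m × PseudoE (m + k)) :=
  Measure.map (fun q : USphere m × PseudoE (k + 1) => (q.1, sliceIncl m k q.1 q.2))
    ((sphereMeasure m).prod (oneSheetMeasure (k + 1)))

/-! ### Every geodesic of the complex is the image of `ℍ^k` under a pseudo-rotation -/

lemma form_eq {n : ℕ} (x y : PseudoE n) : form x y = x.2 * y.2 - inner ℝ x.1 y.1 := by
  simp only [form, PiLp.inner_apply, RCLike.inner_apply, conj_trivial]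
  simp_rw [mul_comm (y.1 _)]
  ring

lemma inner_join {m k : ℕ} (a a' : EuclideanSpace ℝ (Fin m)) (b b' : EuclideanSpace ℝ (Fin k)) :
    inner ℝ (join a b) (join a' b') = inner ℝ a a' + inner ℝ b b' := by
  simp [join, PiLp.inner_apply, Fin.sum_univ_add]

lemma join_add {m k : ℕ} (a a' : EuclideanSpace ℝ (Fin m)) (b b' : EuclideanSpace ℝ (Fin k)) :
    join (a + a') (b + b') = join a b + join a' b' := by
  ext i
  refine Fin.addCases (fun j => ?_) (fun j => ?_) i <;> simp [join]

lemma join_smul {m k : ℕ} (c : ℝ) (a : EuclideanSpace ℝ (Fin m)) (b : EuclideanSpace ℝ (Fin k)) :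
    join (c • a) (c • b) = c • join a b := by
  ext i
  refine Fin.addCases (fun j => ?_) (fun j => ?_) i <;> simp [join]

/-- The hyperbolic boost with parameter `ρ` in the plane spanned by `s` and `e_{n+1}`. -/
def boost {n : ℕ} (s : EuclideanSpace ℝ (Fin n)) (ρ : ℝ) : PseudoE n →ₗ[ℝ] PseudoE n where
  toFun x := (x.1 + ((Real.cosh ρ - 1) * inner ℝ s x.1 + Real.sinh ρ * x.2) • s,
    Real.sinh ρ * inner ℝ s x.1 + Real.cosh ρ * x.2)
  map_add' x y := by
    ext1
    · simp only [Prod.fst_add, Prod.snd_add, inner_add_right]; module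
    · simp only [Prod.fst_add, Prod.snd_add, inner_add_right]; ring
  map_smul' c x := by
    ext1
    · simp only [Prod.smul_fst, Prod.smul_snd, inner_smul_right, RingHom.id_apply, smul_eq_mul]
      module
    · simp only [Prod.smul_fst, Prod.smul_snd, inner_smul_right, RingHom.id_apply, smul_eq_mul]
      ring

lemma boost_apply {n : ℕ} (s : EuclideanSpace ℝ (Fin n)) (ρ : ℝ) (x : PseudoE n) :
    boost s ρ x = (x.1 + ((Real.cosh ρ - 1) * inner ℝ s x.1 + Real.sinh ρ * x.2) • s,
      Real.sinh ρ * inner ℝ s x.1 + Real.cosh ρ * x.2) := rfl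

lemma form_boost {n : ℕ} {s : EuclideanSpace ℝ (Fin n)} (hs : inner ℝ s s = (1 : ℝ)) (ρ : ℝ)
    (x y : PseudoE n) : form (boost s ρ x) (boost s ρ y) = form x y := by
  simp only [form_eq, boost_apply, inner_add_left, inner_add_right, inner_smul_left,
    inner_smul_right, hs, conj_trivial, real_inner_comm s x.1]
  linear_combination (-inner ℝ s x.1 * inner ℝ s y.1 + x.2 * y.2) * Real.cosh_sq ρ

lemma boost_comp {n : ℕ} {s : EuclideanSpace ℝ (Fin n)} (hs : inner ℝ s s = (1 : ℝ)) (ρ τ : ℝ) :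
    boost s ρ ∘ₗ boost s τ = boost s (ρ + τ) := by
  refine LinearMap.ext fun x => ?_
  rw [LinearMap.comp_apply, boost_apply, boost_apply, boost_apply, Real.cosh_add, Real.sinh_add]
  ext1
  · simp only [inner_add_right, inner_smul_right, hs]; module
  · simp only [inner_add_right, inner_smul_right, hs]; ring

lemma det_boost {n : ℕ} {s : EuclideanSpace ℝ (Fin n)} (hs : inner ℝ s s = (1 : ℝ)) (ρ : ℝ) :
    LinearMap.det (boost s ρ) = 1 := by
  let D : PseudoE n →ₗ[ℝ] PseudoE n := LinearMap.prodMap LinearMap.id (-LinearMap.id)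
  have hD : D ∘ₗ D = LinearMap.id := by
    refine LinearMap.ext fun x => ?_
    simp [D]
  have hDB : ∀ τ, D ∘ₗ boost s τ ∘ₗ D = boost s (-τ) := by
    intro τ
    refine LinearMap.ext fun x => ?_
    ext1
    · simp [D, boost_apply]
    · simp [D, boost_apply]
      ring
  have h0 : boost s 0 = LinearMap.id := by
    refine LinearMap.ext fun x => ?_
    simp [boost_apply]
  have d1 : LinearMap.det D * LinearMap.det D = 1 := by
    rw [← LinearMap.det_comp, hD, LinearMap.det_id]
  have d2 : ∀ τ, LinearMap.det (boost s τ) = LinearMap.det (boost s (-τ)) := by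
    intro τ
    rw [← hDB τ, LinearMap.det_comp, LinearMap.det_comp]
    linear_combination (-LinearMap.det (boost s τ)) * d1
  have d3 : LinearMap.det (boost s (ρ / 2)) * LinearMap.det (boost s (ρ / 2)) = 1 := by
    nth_rewrite 2 [d2]
    rw [← LinearMap.det_comp, boost_comp hs, add_neg_cancel, h0, LinearMap.det_id]
  rw [← add_halves ρ, ← boost_comp hs, LinearMap.det_comp, d3]

/-- A linear isometry of `ℝ^k` into `ℝ^{m+k}`, `m ≥ 1`, extends from the last `k` coordinates to a
rotation of `ℝ^{m+k}`. -/
lemma exists_rotation {m k : ℕ} (hm : 1 ≤ m)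
    (g : EuclideanSpace ℝ (Fin k) →ₗᵢ[ℝ] EuclideanSpace ℝ (Fin (m + k))) :
    ∃ R : EuclideanSpace ℝ (Fin (m + k)) →ₗᵢ[ℝ] EuclideanSpace ℝ (Fin (m + k)),
      LinearMap.det R.toLinearMap = 1 ∧ ∀ z, R (join 0 z) = g z := by
  let T : EuclideanSpace ℝ (Fin k) →ₗᵢ[ℝ] EuclideanSpace ℝ (Fin (m + k)) :=
    LinearMap.isometryOfInner
      { toFun := fun z => join 0 z
        map_add' := fun x y => by rw [← join_add, add_zero]
        map_smul' := fun c x => by simp [← join_smul] }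
      (fun x y => by simp [inner_join])
  have hT : ∀ z, T z = join 0 z := fun _ => rfl
  let L := g.comp T.equivRange.symm.toLinearIsometry
  let R₀ := L.extend
  have hR₀ : ∀ z, R₀ (join 0 z) = g z := by
    intro z
    have h1 := L.extend_apply ⟨T z, LinearMap.mem_range_self _ z⟩
    have h2 : T.equivRange.symm ⟨T z, LinearMap.mem_range_self _ z⟩ = z := by
      rw [LinearIsometryEquiv.symm_apply_eq]
      rfl
    rw [← hT]
    refine h1.trans ?_
    change g (T.equivRange.symm ⟨T z, LinearMap.mem_range_self _ z⟩) = g z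
    rw [h2]
  have habs : |LinearMap.det R₀.toLinearMap| = 1 := by
    rw [← LinearMap.normDet_eq_abs_det]
    exact R₀.normDet_eq_one
  rcases (abs_eq (zero_le_one' ℝ)).1 habs with h | h
  · exact ⟨R₀, h, hR₀⟩
  · let e : EuclideanSpace ℝ (Fin m) := EuclideanSpace.single ⟨0, hm⟩ 1
    let u : EuclideanSpace ℝ (Fin (m + k)) := join e 0
    have hu : u ≠ 0 := by
      intro h0
      have : inner ℝ u u = (1 : ℝ) := by
        rw [inner_join, real_inner_self_eq_norm_sq]
        simp [e]
      simp [h0] at this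
    let K : Submodule ℝ (EuclideanSpace ℝ (Fin (m + k))) := (Submodule.span ℝ {u})ᗮ
    refine ⟨R₀.comp K.reflection.toLinearIsometry, ?_, fun z => ?_⟩
    · have hd : LinearMap.det K.reflection.toLinearMap = -1 := by
        rw [Submodule.det_reflection, Submodule.orthogonal_orthogonal, finrank_span_singleton hu,
          pow_one]
      have : (R₀.comp K.reflection.toLinearIsometry).toLinearMap
          = R₀.toLinearMap ∘ₗ K.reflection.toLinearMap := rfl
      rw [this, LinearMap.det_comp, h, hd]
      norm_num
    · have hz : K.reflection (join 0 z) = join 0 z := by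
        rw [Submodule.reflection_eq_self_iff, Submodule.mem_orthogonal_singleton_iff_inner_right]
        simp [u, inner_join]
      change R₀ (K.reflection (join 0 z)) = g z
      rw [hz, hR₀]

/-- For `(v, w)` in the parameter space, `ξ(v, w)` is a `k`-geodesic: some pseudo-rotation takes
`ℍ^k = ℍⁿ ∩ ℝ^{k+1}` to it. -/
lemma exists_pseudoRotation {m k : ℕ} (hm : 1 ≤ m) (q : USphere m × PseudoE (m + k))
    (hq : q ∈ complex m k) :
    ∃ r : PseudoE (m + k) →ₗ[ℝ] PseudoE (m + k),
      IsPseudoRotation r ∧ r '' (tailIncl m k '' hyp k) = geodesic m k q.1 q.2 := by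
  obtain ⟨⟨v, hv⟩, w⟩ := q
  obtain ⟨hw1, hw2⟩ := hq
  simp only at hw1 hw2 ⊢
  have hvv : inner ℝ v v = (1 : ℝ) := by
    rw [real_inner_self_eq_norm_sq, mem_sphere_zero_iff_norm.1 hv, one_pow]
  -- the isometric inclusion of `ℝ × ℝ^k` as `ℝ v ⊕ ℝ^k`
  let I : WithLp 2 (ℝ × EuclideanSpace ℝ (Fin k)) →ₗᵢ[ℝ] EuclideanSpace ℝ (Fin (m + k)) :=
    LinearMap.isometryOfInner
      { toFun := fun z => join (z.fst • v) z.snd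
        map_add' := fun x y => by rw [← join_add, ← add_smul]; rfl
        map_smul' := fun c x => by rw [RingHom.id_apply, ← join_smul, ← mul_smul]; rfl }
      (fun x y => by
        change inner ℝ (join (x.fst • v) x.snd) (join (y.fst • v) y.snd) = _
        rw [inner_join, inner_smul_left, inner_smul_right, hvv, WithLp.prod_inner_apply]
        simp [mul_comm])
  have hI : ∀ z, I z = join (z.fst • v) z.snd := fun _ => rfl
  have hslice : ∀ x : PseudoE (m + k), x ∈ sliceSpace m k v ↔ ∃ z, x.1 = I z := by
    intro x
    constructor
    · rintro ⟨s, z, rfl⟩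
      refine ⟨WithLp.toLp 2 (s, z.1), ?_⟩
      rw [hI, Prod.fst_add, tailIncl, ← join_add, add_zero, zero_add]
      rfl
    · rintro ⟨z, hz⟩
      refine ⟨z.fst, (z.snd, x.2), ?_⟩
      ext1
      · rw [Prod.fst_add, tailIncl, ← join_add, add_zero, zero_add, hz, hI]
      · simp [tailIncl]
  obtain ⟨a, ha⟩ := (hslice w).1 hw2
  obtain ⟨ρ, hρ⟩ : ∃ ρ, w.2 = Real.sinh ρ := ⟨Real.arsinh w.2, (Real.sinh_arsinh _).symm⟩
  have hc : 0 < Real.cosh ρ := Real.cosh_pos ρ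
  have haa : inner ℝ a a = Real.cosh ρ ^ 2 := by
    have h : form w w = -1 := hw1
    rw [form_eq, ha, I.inner_map_map, hρ] at h
    rw [Real.cosh_sq]
    linarith
  obtain ⟨σ, haσ⟩ : ∃ σ, a = Real.cosh ρ • σ :=
    ⟨(Real.cosh ρ)⁻¹ • a, by rw [smul_smul, mul_inv_cancel₀ hc.ne', one_smul]⟩
  have hσσ : inner ℝ σ σ = (1 : ℝ) := by
    rw [haσ, inner_smul_left, inner_smul_right, conj_trivial, ← mul_assoc, ← sq] at haa
    exact mul_left_cancel₀ (pow_pos hc 2).ne' (haa.trans (mul_one _).symm)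
  have hσ0 : σ ≠ 0 := by
    intro h
    simp [h] at hσσ
  have hs : inner ℝ (I σ) (I σ) = (1 : ℝ) := by rw [I.inner_map_map, hσσ]
  have hwρ : w = (Real.cosh ρ • I σ, Real.sinh ρ) := by
    ext1
    · rw [ha, haσ, map_smul]
    · exact hρ
  let W : Submodule ℝ (WithLp 2 (ℝ × EuclideanSpace ℝ (Fin k))) := (Submodule.span ℝ {σ})ᗮ
  have hfr : Module.finrank ℝ (WithLp 2 (ℝ × EuclideanSpace ℝ (Fin k))) = k + 1 := by
    rw [(WithLp.linearEquiv 2 ℝ (ℝ × EuclideanSpace ℝ (Fin k))).finrank_eq]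
    simp [Module.finrank_prod, add_comm]
  have : Fact (Module.finrank ℝ (WithLp 2 (ℝ × EuclideanSpace ℝ (Fin k))) = k + 1) := ⟨hfr⟩
  have hW : Module.finrank ℝ W = k := Submodule.finrank_orthogonal_span_singleton hσ0
  let e : EuclideanSpace ℝ (Fin k) ≃ₗᵢ[ℝ] W :=
    ((stdOrthonormalBasis ℝ W).reindex (finCongr hW)).repr.symm
  obtain ⟨R, hR, hRz⟩ := exists_rotation hm ((I.comp W.subtypeₗᵢ).comp e.toLinearIsometry)
  have hRe : ∀ z, R (join 0 z) = I (e z : WithLp 2 (ℝ × EuclideanSpace ℝ (Fin k))) := hRz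
  have hσe : ∀ z, inner ℝ σ (e z : WithLp 2 (ℝ × EuclideanSpace ℝ (Fin k))) = (0 : ℝ) :=
    fun z => Submodule.mem_orthogonal_singleton_iff_inner_right.1 (e z).2
  let r : PseudoE (m + k) →ₗ[ℝ] PseudoE (m + k) :=
    boost (I σ) ρ ∘ₗ LinearMap.prodMap R.toLinearMap LinearMap.id
  have hform : ∀ x y, form (r x) (r y) = form x y := by
    intro x y
    change form (boost (I σ) ρ (R x.1, x.2)) (boost (I σ) ρ (R y.1, y.2)) = form x y
    rw [form_boost hs, form_eq, form_eq, R.inner_map_map]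
  have hr : ∀ z : PseudoE k, r (tailIncl m k z)
      = (I ((e z.1 : WithLp 2 (ℝ × EuclideanSpace ℝ (Fin k))) + (Real.sinh ρ * z.2) • σ),
        Real.cosh ρ * z.2) := by
    intro z
    change boost (I σ) ρ (R (join 0 z.1), z.2) = _
    rw [boost_apply, hRe, I.inner_map_map, hσe, map_add, map_smul]
    simp
  have htail : ∀ z : PseudoE k, form (tailIncl m k z) (tailIncl m k z) = form z z := by
    intro z
    rw [form_eq, form_eq, tailIncl, inner_join, inner_zero_left, zero_add]
  refine ⟨r, ⟨hform, ?_, ?_⟩, ?_⟩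
  · rw [LinearMap.det_comp, det_boost hs, LinearMap.det_prodMap, hR, LinearMap.det_id]
    norm_num
  · change 0 < (boost (I σ) ρ (R 0, 1)).2
    simpa [boost_apply] using hc
  · ext x
    constructor
    · rintro ⟨_, ⟨z, ⟨hz1, hz2⟩, rfl⟩, rfl⟩
      refine ⟨⟨⟨by rw [hform, htail, hz1], ?_⟩, ?_⟩, ?_⟩
      · rw [hr]
        exact mul_pos hc hz2
      · exact (hslice _).2 ⟨_, by rw [hr]⟩
      · rw [hr, hwρ, form_eq, inner_smul_right, I.inner_map_map, inner_add_left,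
          inner_smul_left, real_inner_comm, hσe, hσσ]
        simp only [conj_trivial]
        ring
    · rintro ⟨⟨⟨hx1, hx2⟩, hx3⟩, hx4⟩
      obtain ⟨y, hy⟩ := (hslice x).1 hx3
      have hyσ : Real.cosh ρ * inner ℝ σ y = x.2 * Real.sinh ρ := by
        rw [hwρ, form_eq, hy, inner_smul_right, I.inner_map_map, real_inner_comm] at hx4
        linarith
      have hmem : y - (Real.sinh ρ * (x.2 / Real.cosh ρ)) • σ ∈ W := by
        rw [Submodule.mem_orthogonal_singleton_iff_inner_right, inner_sub_right,
          inner_smul_right, hσσ]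
        field_simp
        linarith
      have hrx : r (tailIncl m k (e.symm ⟨_, hmem⟩, x.2 / Real.cosh ρ)) = x := by
        rw [hr]
        ext1
        · simp [hy]
        · simp only
          field_simp
      refine ⟨_, ⟨(e.symm ⟨_, hmem⟩, x.2 / Real.cosh ρ), ⟨?_, div_pos hx2 hc⟩, rfl⟩, hrx⟩
      rw [← htail, ← hform, hrx, hx1]

/-! ### The restricted totally geodesic transform -/

open Classical in
/-- The measure `d_ξ x` on a `k`-geodesic `ξ`: the image of the canonical measure of `ℍ^k` under a
pseudo-rotation that takes `ℍ^k = ℍⁿ ∩ ℝ^{k+1}` to `ξ`. (The value `0` is used only for sets `ξ`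
that are not `k`-geodesics; by `exists_pseudoRotation` the sets `ξ(v, w)` are `k`-geodesics.) -/
def geodesicMeasure (m k : ℕ) (ξ : Set (PseudoE (m + k))) : Measure (PseudoE (m + k)) :=
  if h : ∃ r : PseudoE (m + k) →ₗ[ℝ] PseudoE (m + k),
      IsPseudoRotation r ∧ r '' (tailIncl m k '' hyp k) = ξ then
    Measure.map (fun u => h.choose (tailIncl m k u)) (hypMeasure k)
  else 0

/-- The integral defining the restricted transform
`(H̃_k f)(v, w) = ∫_{x ∈ ℍ_v^{k+1} : [x, w] = 0} f(x) d_{v,w}x` exists as a finite Lebesgue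
integral. -/
def RestrictedTransformFinite {𝕜 : Type*} [RCLike 𝕜] (m k : ℕ) (f : PseudoE (m + k) → 𝕜)
    (v : USphere m) (w : PseudoE (m + k)) : Prop :=
  Integrable f (geodesicMeasure m k (geodesic m k v w))

end HypRadon

end

/-! Every measure in the statement is traced back to Lebesgue measure on a light cone, where Fubini
and linear changes of variables suffice. Write `m = n - k`. A nonnegative Borel function `F` on
hyperbolic space is lifted to the degree-zero homogeneous function `coneLift F`, cut off to `1 < [Y,
Y] < 4`. By polar coordinates `Y = t x`, its Lebesgue integral is `∫ F dx` times the finite positive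
constant `∫_1^2 t^n dt` (`lintegral_coneLift`).

The weight `|x'|^{1-m}` is the one that makes slicing harmless. It cancels the polar Jacobian in the
variable `x'`, so integrating over all slices through directions `v` is, up to a factor 2,
integrating with this weight (`lintegral_lintegral_sliceIncl`). Hence for almost every `v` the lift
restricted to the slice, a space of type `𝔼^{k+1,1}`, is in `L^p` for Lebesgue measure.

Inside one slice, fix a spatial unit vector `σ`. As `ρ` varies, the hyperplanes orthogonal to `w = σ
cosh ρ + e sinh ρ` meet the plane of `σ` and the time axis in rays with hyperbolic angle `ρ`. In
that plane hyperbolic polar coordinates have Jacobian `t = y / cosh ρ`, with `y` the time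
coordinate. Thus the integral over `ρ` of `(cosh ρ)⁻¹` times the hyperplane integral is at most `∫ Φ
/ y` (`lintegral_hyperplaneIntegral_le`). The right side is finite for `Φ` in `L^p`. The conjugate
exponent `q` satisfies `q > k` exactly because `p (k - 1) < k`, and `y^{-q}` is integrable on
`ℍ^{k+1}` for such `q` (`lintegral_div_time_lt_top`). So for every `σ`, almost every `ρ` gives a
finite hyperplane integral.

Finally, a pseudo-rotation carrying `ℍ^k` to the geodesic is linear and preserves the form. It
therefore parametrizes the hyperplane `w^⊥` of the slice isometrically, and the same polar
coordinates bound the geodesic integral by the hyperplane integral of the lift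
(`lintegral_geodesicMeasure_le`). -/

noncomputable section

namespace HypRadon

/-! ### Polar coordinates -/

/-- Multiplication by a positive constant changes the variable on the half-line. -/
lemma lintegral_Ioi_comp_div {c : ℝ} (hc : 0 < c) (g : ℝ → ℝ≥0∞) :
    ∫⁻ t in Ioi (0 : ℝ), g t = ∫⁻ y in Ioi (0 : ℝ), ENNReal.ofReal c⁻¹ * g (y / c) := by
  have himg : (fun y : ℝ => y / c) '' Ioi 0 = Ioi 0 := by
    ext t
    constructor
    · rintro ⟨y, hy, rfl⟩
      exact div_pos hy hc
    · intro ht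
      exact ⟨t * c, mul_pos ht hc, mul_div_cancel_right₀ t hc.ne'⟩
  have hd : ∀ y ∈ Ioi (0 : ℝ), HasDerivWithinAt (fun y : ℝ => y / c) c⁻¹ (Ioi 0) y := by
    intro y _
    simpa [one_div] using (hasDerivWithinAt_id y (Ioi (0 : ℝ))).div_const c
  have hinj : InjOn (fun y : ℝ => y / c) (Ioi 0) := fun a _ b _ h => by
    simpa [div_left_inj' hc.ne'] using h
  have := lintegral_image_eq_lintegral_abs_deriv_mul measurableSet_Ioi hd hinj g
  rw [himg] at this
  rw [this, abs_of_pos (inv_pos.2 hc)]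

/-- The substitution `s = y tanh r`. -/
lemma lintegral_Ioo_eq_lintegral_tanh {y : ℝ} (hy : 0 < y) (g : ℝ → ℝ≥0∞) :
    ∫⁻ s in Ioo (-y) y, g s
      = ∫⁻ r : ℝ, ENNReal.ofReal (y / Real.cosh r ^ 2) * g (y / Real.cosh r * Real.sinh r) := by
  have heq : ∀ r : ℝ, y / Real.cosh r * Real.sinh r = y * Real.tanh r := by
    intro r
    rw [Real.tanh_eq_sinh_div_cosh]
    ring
  have himg : (fun r : ℝ => y / Real.cosh r * Real.sinh r) '' univ = Ioo (-y) y := by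
    ext s
    simp only [heq]
    constructor
    · rintro ⟨r, _, rfl⟩
      have h1 := Real.tanh_lt_one r
      have h2 := Real.neg_one_lt_tanh r
      constructor <;> nlinarith
    · rintro ⟨h1, h2⟩
      have hs : s / y ∈ Ioo (-1 : ℝ) 1 := by
        rw [mem_Ioo, lt_div_iff₀ hy, div_lt_iff₀ hy]
        constructor <;> linarith
      refine ⟨Real.artanh (s / y), mem_univ _, ?_⟩
      simp only [Real.tanh_artanh hs]
      field_simp
  have hd : ∀ r ∈ (univ : Set ℝ), HasDerivWithinAt
      (fun r : ℝ => y / Real.cosh r * Real.sinh r) (y / Real.cosh r ^ 2) univ r := by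
    intro r _
    have hc := (Real.cosh_pos r).ne'
    have h := (((hasDerivAt_const r y).div (Real.hasDerivAt_cosh r) hc).mul
      (Real.hasDerivAt_sinh r)).hasDerivWithinAt (s := univ)
    refine h.congr_deriv ?_
    simp only [Pi.div_apply]
    field_simp
    linear_combination y * Real.cosh_sq r
  have hinj : InjOn (fun r : ℝ => y / Real.cosh r * Real.sinh r) univ := by
    intro a _ b _ h
    simp only [heq] at h
    exact Real.tanh_injective (mul_left_cancel₀ hy.ne' h)
  have := lintegral_image_eq_lintegral_abs_deriv_mul MeasurableSet.univ hd hinj g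
  rw [himg, setLIntegral_univ] at this
  rw [this]
  refine lintegral_congr fun r => ?_
  rw [abs_of_pos (by have := Real.cosh_pos r; positivity)]

/-- Hyperbolic polar coordinates `(s, y) = (t sinh r, t cosh r)` in the forward light cone of the
plane. -/
lemma lintegral_hyperbolicPolar (g : ℝ → ℝ → ℝ≥0∞) (hg : Measurable (Function.uncurry g)) :
    ∫⁻ y in Ioi (0 : ℝ), ∫⁻ s in Ioo (-y) y, g s y
      = ∫⁻ t in Ioi (0 : ℝ), ∫⁻ r : ℝ,
          ENNReal.ofReal t * g (t * Real.sinh r) (t * Real.cosh r) := by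
  have hm1 : Measurable fun q : ℝ × ℝ =>
      ENNReal.ofReal q.1 * g (q.1 * Real.sinh q.2) (q.1 * Real.cosh q.2) := by
    refine (ENNReal.measurable_ofReal.comp measurable_fst).mul (hg.comp (Measurable.prodMk ?_ ?_))
    · exact measurable_fst.mul (Real.measurable_sinh.comp measurable_snd)
    · exact measurable_fst.mul (Real.measurable_cosh.comp measurable_snd)
  have hm2 : Measurable fun q : ℝ × ℝ => ENNReal.ofReal (q.2 / Real.cosh q.1 ^ 2) *
      g (q.2 / Real.cosh q.1 * Real.sinh q.1) q.2 := by
    have hc : Measurable fun q : ℝ × ℝ => Real.cosh q.1 := Real.measurable_cosh.comp measurable_fst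
    have hs : Measurable fun q : ℝ × ℝ => Real.sinh q.1 := Real.measurable_sinh.comp measurable_fst
    refine (ENNReal.measurable_ofReal.comp (measurable_snd.div (hc.pow_const 2))).mul
      (hg.comp (Measurable.prodMk ?_ measurable_snd))
    exact (measurable_snd.div hc).mul hs
  -- With the angle `r` fixed, `t = y / cosh r` replaces `t` by `y`. After swapping back, `s = y
  -- tanh r` replaces `r` at fixed `y`.
  rw [lintegral_lintegral_swap hm1.aemeasurable]
  have h1 : ∀ r : ℝ, ∫⁻ t in Ioi (0 : ℝ),
      ENNReal.ofReal t * g (t * Real.sinh r) (t * Real.cosh r)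
      = ∫⁻ y in Ioi (0 : ℝ), ENNReal.ofReal (y / Real.cosh r ^ 2) *
          g (y / Real.cosh r * Real.sinh r) y := by
    intro r
    have hc := Real.cosh_pos r
    rw [lintegral_Ioi_comp_div hc]
    refine setLIntegral_congr_fun measurableSet_Ioi fun y hy => ?_
    rw [← mul_assoc, ← ENNReal.ofReal_mul (by positivity), div_mul_cancel₀ y hc.ne']
    congr 2
    field_simp
  simp_rw [h1]
  rw [lintegral_lintegral_swap hm2.aemeasurable]
  exact setLIntegral_congr_fun measurableSet_Ioi fun y hy =>
    lintegral_Ioo_eq_lintegral_tanh hy fun s => g s y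

/-- Polar coordinates in `ℝⁿ`, for the Lebesgue integral of nonnegative functions. -/
lemma lintegral_polar {n : ℕ} (hn : 1 ≤ n) (g : EuclideanSpace ℝ (Fin n) → ℝ≥0∞)
    (hg : Measurable g) :
    ∫⁻ x, g x = ∫⁻ θ, (∫⁻ s in Ioi (0 : ℝ),
      ENNReal.ofReal (s ^ (n - 1)) * g (s • (θ : EuclideanSpace ℝ (Fin n)))) ∂(sphereMeasure n) := by
  have : Nonempty (Fin n) := ⟨⟨0, hn⟩⟩
  have hfr : Module.finrank ℝ (EuclideanSpace ℝ (Fin n)) = n := by simp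
  have hμ := (volume : Measure (EuclideanSpace ℝ (Fin n))).measurePreserving_homeomorphUnitSphereProd
  rw [hfr] at hμ
  have hG : Measurable fun q : USphere n × Ioi (0 : ℝ) =>
      g ((q.2 : ℝ) • (q.1 : EuclideanSpace ℝ (Fin n))) := by
    refine hg.comp ?_
    exact (measurable_subtype_coe.comp measurable_snd).smul
      (measurable_subtype_coe.comp measurable_fst)
  calc ∫⁻ x, g x = ∫⁻ x in ({0}ᶜ : Set (EuclideanSpace ℝ (Fin n))), g x := by
        rw [restrict_compl_singleton]
    _ = ∫⁻ x : ({0}ᶜ : Set (EuclideanSpace ℝ (Fin n))), g x ∂(volume.comap Subtype.val) :=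
        (lintegral_subtype_comap (measurableSet_singleton _).compl g).symm
    _ = ∫⁻ q, g ((q.2 : ℝ) • (q.1 : EuclideanSpace ℝ (Fin n)))
          ∂((sphereMeasure n).prod (Measure.volumeIoiPow (n - 1))) := by
        rw [sphereMeasure, ← hμ.lintegral_comp hG]
        refine lintegral_congr fun x => ?_
        congr 1
        have := congrArg Subtype.val ((homeomorphUnitSphereProd
          (EuclideanSpace ℝ (Fin n))).symm_apply_apply x)
        rw [homeomorphUnitSphereProd_symm_apply_coe] at this
        exact this.symm
    _ = _ := by
        rw [lintegral_prod _ hG.aemeasurable]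
        refine lintegral_congr fun θ => ?_
        rw [Measure.volumeIoiPow, lintegral_withDensity_eq_lintegral_mul _ (by fun_prop)
          (by exact hG.comp measurable_prodMk_left)]
        exact lintegral_subtype_comap measurableSet_Ioi
          fun s => ENNReal.ofReal (s ^ (n - 1)) * g (s • (θ : EuclideanSpace ℝ (Fin n)))

/-! ### Volume-preserving linear maps -/

/-- An isometry of the Euclidean product `U × V` onto a space of the same dimension preserves the
volume. -/
lemma measurePreserving_of_norm_sq {U V W : Type*}
    [NormedAddCommGroup U] [InnerProductSpace ℝ U] [MeasurableSpace U] [BorelSpace U]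
    [FiniteDimensional ℝ U]
    [NormedAddCommGroup V] [InnerProductSpace ℝ V] [MeasurableSpace V] [BorelSpace V]
    [FiniteDimensional ℝ V]
    [NormedAddCommGroup W] [InnerProductSpace ℝ W] [MeasurableSpace W] [BorelSpace W]
    [FiniteDimensional ℝ W]
    (f : U × V →ₗ[ℝ] W) (hf : ∀ x, ‖f x‖ ^ 2 = ‖x.1‖ ^ 2 + ‖x.2‖ ^ 2)
    (hd : Module.finrank ℝ U + Module.finrank ℝ V = Module.finrank ℝ W) :
    MeasurePreserving f := by
  let J : WithLp 2 (U × V) →ₗᵢ[ℝ] W :=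
    { toLinearMap := f ∘ₗ (WithLp.linearEquiv 2 ℝ (U × V)).toLinearMap
      norm_map' := fun x => by
        have h1 : ‖f (WithLp.linearEquiv 2 ℝ (U × V) x)‖ ^ 2 = ‖x‖ ^ 2 := by
          rw [hf, WithLp.prod_norm_sq_eq_of_L2]
          rfl
        exact (pow_left_inj₀ (norm_nonneg _) (norm_nonneg _) two_ne_zero).1 h1 }
  have hdim : Module.finrank ℝ (WithLp 2 (U × V)) = Module.finrank ℝ W := by
    rw [(WithLp.linearEquiv 2 ℝ (U × V)).finrank_eq, Module.finrank_prod, hd]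
  exact (J.toLinearIsometryEquiv hdim).measurePreserving.comp (WithLp.volume_preserving_toLp U V)

/-! ### The form -/

lemma continuous_form {n : ℕ} : Continuous fun q : PseudoE n × PseudoE n => form q.1 q.2 := by
  simp only [form_eq]
  fun_prop

lemma measurable_form {n : ℕ} {α : Type*} [MeasurableSpace α] {f g : α → PseudoE n}
    (hf : Measurable f) (hg : Measurable g) : Measurable fun a => form (f a) (g a) :=
  continuous_form.measurable.comp (hf.prodMk hg)

lemma form_smul_smul {n : ℕ} (a b : ℝ) (x y : PseudoE n) :
    form (a • x) (b • y) = a * b * form x y := by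
  simp only [form_eq, Prod.smul_fst, Prod.smul_snd, inner_smul_left, inner_smul_right, smul_eq_mul,
    conj_trivial]
  ring

lemma form_add_left {n : ℕ} (x y z : PseudoE n) : form (x + y) z = form x z + form y z := by
  simp only [form_eq, Prod.fst_add, Prod.snd_add, inner_add_left]
  ring

lemma form_smul_left {n : ℕ} (a : ℝ) (x y : PseudoE n) : form (a • x) y = a * form x y := by
  simp only [form_eq, Prod.smul_fst, Prod.smul_snd, inner_smul_left, smul_eq_mul, conj_trivial]
  ring

lemma form_comm {n : ℕ} (x y : PseudoE n) : form x y = form y x := by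
  rw [form_eq, form_eq, real_inner_comm, mul_comm]

/-- The form as a bilinear form. -/
def formBilin (n : ℕ) : LinearMap.BilinForm ℝ (PseudoE n) :=
  LinearMap.mk₂ ℝ form form_add_left form_smul_left
    (fun x y z => by rw [form_comm, form_add_left, form_comm y, form_comm z])
    (fun a x y => by rw [form_comm, form_smul_left, form_comm y]; rfl)

/-- Pairing `x` with its reflection `(-x.1, x.2)` turns the form into the positive definite sum
`‖x.1‖² + x.2²`. -/
lemma formBilin_nondegenerate (n : ℕ) : (formBilin n).Nondegenerate := by
  have key : ∀ x : PseudoE n, (∀ y, form x y = 0) → x = 0 := by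
    intro x hx
    have h := hx (-x.1, x.2)
    rw [form_eq, inner_neg_right, real_inner_self_eq_norm_sq] at h
    have h1 : x.1 = 0 := norm_eq_zero.1 (by nlinarith [sq_nonneg ‖x.1‖, sq_nonneg x.2])
    have h2 : x.2 = 0 := by nlinarith [sq_nonneg ‖x.1‖, sq_nonneg x.2]
    exact Prod.ext h1 h2
  exact ⟨fun x hx => key x hx, fun x hx => key x fun y => by rw [form_comm]; exact hx y⟩

/-- A linear map that preserves the form preserves the volume. -/
lemma measurePreserving_of_form {n : ℕ} (A : PseudoE n →ₗ[ℝ] PseudoE n)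
    (hA : ∀ x, form (A x) (A x) = form x x) : MeasurePreserving A := by
  -- Polarization: expand the form at `x + y`.
  have hA' : ∀ x y, form (A x) (A y) = form x y := by
    intro x y
    have h := hA (x + y)
    rw [map_add, form_add_left, form_add_left, form_comm _ (A x + A y), form_comm _ (A x + A y),
      form_add_left, form_add_left, form_comm _ (x + y), form_comm _ (x + y), form_add_left,
      form_add_left, hA, hA, form_comm (A y) (A x), form_comm y x] at h
    linarith
  let b := Module.finBasis ℝ (PseudoE n)
  have hcomp : (formBilin n).comp A A = formBilin n :=
    LinearMap.ext₂ fun x y => hA' x y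
  -- In a basis, with Gram matrix `B`, invariance reads `Aᵀ B A = B`. Since `det B ≠ 0`, this forces
  -- `(det A)² = 1`.
  have hmat := LinearMap.BilinForm.toMatrix_comp b b (formBilin n) A A
  rw [hcomp] at hmat
  have hdet := congrArg Matrix.det hmat
  rw [Matrix.det_mul, Matrix.det_mul, Matrix.det_transpose, LinearMap.det_toMatrix] at hdet
  have hB := (LinearMap.BilinForm.nondegenerate_iff_det_ne_zero b).1 (formBilin_nondegenerate n)
  have hsq : LinearMap.det A ^ 2 = 1 := by
    refine mul_right_cancel₀ hB ?_
    rw [one_mul]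
    linear_combination -hdet
  have habs : |LinearMap.det A| = 1 := by
    rwa [← sq_eq_sq₀ (abs_nonneg _) zero_le_one, sq_abs, one_pow]
  have h0 : LinearMap.det A ≠ 0 := fun h => by simp [h] at hsq
  refine ⟨(LinearMap.continuous_of_finiteDimensional A).measurable, ?_⟩
  have : (volume : Measure (PseudoE n)).IsAddHaarMeasure := by
    rw [Measure.volume_eq_prod]
    infer_instance
  rw [Measure.map_linearMap_addHaar_eq_smul_addHaar _ h0, abs_inv, habs]
  simp

/-! ### The lift of a function on `ℍⁿ` to the light cone -/

/-- The lift of a function on `ℍⁿ` to a homogeneous function of degree zero on the part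
`1 < [Y, Y] < 4` of the forward light cone, extended by zero. -/
def coneLift {n : ℕ} (F : PseudoE n → ℝ≥0∞) (Y : PseudoE n) : ℝ≥0∞ :=
  if 1 < form Y Y ∧ form Y Y < 4 ∧ 0 < Y.2 then F ((√(form Y Y))⁻¹ • Y) else 0

lemma measurable_coneLift {n : ℕ} {F : PseudoE n → ℝ≥0∞} (hF : Measurable F) :
    Measurable (coneLift F) := by
  have hm : Measurable fun Y : PseudoE n => form Y Y := measurable_form measurable_id measurable_id
  refine Measurable.ite ?_ (hF.comp (by fun_prop)) measurable_const
  exact (measurableSet_lt measurable_const hm).inter ((measurableSet_lt hm measurable_const).inter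
    (measurableSet_lt measurable_const measurable_snd))

lemma coneLift_eq_zero {n : ℕ} (F : PseudoE n → ℝ≥0∞) {Y : PseudoE n}
    (h : Y.2 ≤ 0 ∨ form Y Y ≤ 1) : coneLift F Y = 0 := by
  refine if_neg fun h' => ?_
  rcases h with h | h
  · exact absurd h'.2.2 h.not_gt
  · exact absurd h'.1 h.not_gt

/-- On the ray through `z` one has `[t z, t z] = t²`, so the cutoff depends on the radial variable
alone and normalization returns `z`. This is what separates the variables in polar coordinates. -/
lemma coneLift_smul {n : ℕ} (F : PseudoE n → ℝ≥0∞) {z : PseudoE n} (hz : z ∈ hyp n) {t : ℝ}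
    (ht : 0 < t) : coneLift F (t • z) = if 1 < t ∧ t < 2 then F z else 0 := by
  have hf : form (t • z) (t • z) = t ^ 2 := by
    rw [form_smul_smul, hz.1]
    ring
  have h1 : 1 < t ^ 2 ↔ 1 < t := by
    constructor <;> intro h <;> nlinarith
  have h2 : t ^ 2 < 4 ↔ t < 2 := by
    constructor <;> intro h <;> nlinarith
  have h3 : 0 < (t • z).2 := mul_pos ht hz.2
  unfold coneLift
  rw [hf, Real.sqrt_sq ht.le, smul_smul, inv_mul_cancel₀ ht.ne', one_smul]
  simp only [h1, h2, h3, and_true]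

lemma sphericalPoint_mem_hyp {n : ℕ} (θ : USphere n) (r : ℝ) :
    (Real.sinh r • (θ : EuclideanSpace ℝ (Fin n)), Real.cosh r) ∈ hyp n := by
  refine ⟨?_, Real.cosh_pos r⟩
  rw [form_eq, inner_smul_left, inner_smul_right, real_inner_self_eq_norm_sq,
    mem_sphere_zero_iff_norm.1 θ.2, conj_trivial]
  linear_combination Real.cosh_sq r

instance (n : ℕ) : IsFiniteMeasure (sphereMeasure n) := by
  unfold sphereMeasure
  infer_instance

lemma lintegral_hypMeasure {n : ℕ} {F : PseudoE n → ℝ≥0∞} (hF : Measurable F) :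
    ∫⁻ x, F x ∂(hypMeasure n) = ∫⁻ θ, (∫⁻ r in Ioi (0 : ℝ), ENNReal.ofReal (Real.sinh r ^ (n - 1)) *
      F (Real.sinh r • (θ : EuclideanSpace ℝ (Fin n)), Real.cosh r)) ∂(sphereMeasure n) := by
  have hφ : Measurable fun q : USphere n × ℝ =>
      ((Real.sinh q.2 • (q.1 : EuclideanSpace ℝ (Fin n)), Real.cosh q.2) : PseudoE n) := by
    have : Continuous fun q : USphere n × ℝ =>
      ((Real.sinh q.2 • (q.1 : EuclideanSpace ℝ (Fin n)), Real.cosh q.2) : PseudoE n) := by fun_prop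
    exact this.measurable
  rw [hypMeasure, lintegral_map hF hφ]
  refine (lintegral_prod _ (hF.comp hφ).aemeasurable).trans (lintegral_congr fun θ => ?_)
  exact lintegral_withDensity_eq_lintegral_mul _ (by fun_prop)
    ((hF.comp hφ).comp (measurable_prodMk_left (x := θ)))

/-- The integral of `t ↦ tⁿ` that relates a function on `ℍⁿ` to its lift. -/
def coneConst (n : ℕ) : ℝ≥0∞ := ∫⁻ t in Ioo (1 : ℝ) 2, ENNReal.ofReal (t ^ n)

/-- Together with finiteness below, this lets finiteness pass in both directions between a function
and its lift. -/
lemma coneConst_ne_zero (n : ℕ) : coneConst n ≠ 0 := by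
  have h : ∫⁻ _ in Ioo (1 : ℝ) 2, (1 : ℝ≥0∞) ≤ coneConst n := by
    refine setLIntegral_mono' measurableSet_Ioo fun t ht => ?_
    rw [← ENNReal.ofReal_one]
    exact ENNReal.ofReal_le_ofReal (one_le_pow₀ ht.1.le)
  rw [setLIntegral_one, Real.volume_Ioo] at h
  intro h0
  rw [h0] at h
  norm_num at h

lemma coneConst_ne_top (n : ℕ) : coneConst n ≠ ∞ := by
  have h : coneConst n ≤ ∫⁻ _ in Ioo (1 : ℝ) 2, ENNReal.ofReal (2 ^ n) := by
    refine setLIntegral_mono' measurableSet_Ioo fun t ht => ?_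
    exact ENNReal.ofReal_le_ofReal (pow_le_pow_left₀ (by linarith [ht.1]) ht.2.le n)
  rw [setLIntegral_const, Real.volume_Ioo] at h
  exact (h.trans_lt (ENNReal.mul_lt_top ENNReal.ofReal_lt_top ENNReal.ofReal_lt_top)).ne

/-- The integral of the lift in one plane through the time axis. -/
lemma lintegral_coneLift_ray {n : ℕ} (hn : 1 ≤ n) {F : PseudoE n → ℝ≥0∞} (hF : Measurable F)
    (θ : USphere n) :
    ∫⁻ y : ℝ, ∫⁻ s in Ioi (0 : ℝ), ENNReal.ofReal (s ^ (n - 1)) *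
        coneLift F (s • (θ : EuclideanSpace ℝ (Fin n)), y)
      = coneConst n * ∫⁻ r in Ioi (0 : ℝ), ENNReal.ofReal (Real.sinh r ^ (n - 1)) *
        F (Real.sinh r • (θ : EuclideanSpace ℝ (Fin n)), Real.cosh r) := by
  have hθ : ‖(θ : EuclideanSpace ℝ (Fin n))‖ = 1 := mem_sphere_zero_iff_norm.1 θ.2
  have hform : ∀ s y : ℝ, form ((s • (θ : EuclideanSpace ℝ (Fin n)), y) : PseudoE n)
      (s • (θ : EuclideanSpace ℝ (Fin n)), y) = y ^ 2 - s ^ 2 := by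
    intro s y
    rw [form_eq, inner_smul_left, inner_smul_right, real_inner_self_eq_norm_sq, hθ, conj_trivial]
    ring
  -- Hyperbolic polar coordinates use angles of both signs, whereas the Euclidean radius `s` is
  -- positive. The indicator keeps the half `s > 0`, that is, `r > 0`.
  let g : ℝ → ℝ → ℝ≥0∞ := fun s y => (Ioi (0 : ℝ)).indicator (fun s => ENNReal.ofReal (s ^ (n - 1)) *
    coneLift F (s • (θ : EuclideanSpace ℝ (Fin n)), y)) s
  have hcm : Measurable fun q : ℝ × ℝ => ENNReal.ofReal (q.1 ^ (n - 1)) *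
      coneLift F (q.1 • (θ : EuclideanSpace ℝ (Fin n)), q.2) := by
    refine Measurable.mul (by fun_prop) ((measurable_coneLift hF).comp ?_)
    fun_prop
  have hg : Measurable (Function.uncurry g) :=
    hcm.indicator (measurable_fst measurableSet_Ioi)
  -- The lift vanishes for `y ≤ 0` and for `s ≥ y > 0`, where the form `y² - s²` is not positive, so
  -- only the forward cone contributes.
  have hleft : ∫⁻ y : ℝ, ∫⁻ s in Ioi (0 : ℝ), ENNReal.ofReal (s ^ (n - 1)) *
        coneLift F (s • (θ : EuclideanSpace ℝ (Fin n)), y)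
      = ∫⁻ y in Ioi (0 : ℝ), ∫⁻ s in Ioo (-y) y, g s y := by
    rw [← lintegral_indicator measurableSet_Ioi]
    refine lintegral_congr fun y => ?_
    rw [← lintegral_indicator measurableSet_Ioi]
    by_cases hy : y ∈ Ioi (0 : ℝ)
    · rw [indicator_of_mem hy, ← lintegral_indicator measurableSet_Ioo]
      refine lintegral_congr fun s => ?_
      by_cases hs : s ∈ Ioo (-y) y
      · rw [indicator_of_mem hs]
      · rw [indicator_of_notMem hs]
        by_cases hs0 : s ∈ Ioi (0 : ℝ)
        · rw [indicator_of_mem hs0, coneLift_eq_zero F (Or.inr ?_), mul_zero]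
          rw [hform]
          have h0 : 0 < s := hs0
          have h1 : 0 < y := hy
          have : y ≤ s := by
            by_contra hlt
            exact hs ⟨by linarith, not_le.1 hlt⟩
          nlinarith
        · rw [indicator_of_notMem hs0]
    · rw [indicator_of_notMem hy]
      refine (lintegral_congr fun s => ?_).trans lintegral_zero
      refine indicator_apply_eq_zero.2 fun _ => ?_
      rw [coneLift_eq_zero F (Or.inl (show y ≤ 0 from not_lt.1 hy)), mul_zero]
  -- The Jacobian `t` and the factor `(t sinh r)^{n-1}` combine to `t^n sinh^{n-1} r`, so the
  -- integral splits as a product.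
  have hcore : ∀ t ∈ Ioi (0 : ℝ), ∫⁻ r : ℝ,
      ENNReal.ofReal t * g (t * Real.sinh r) (t * Real.cosh r)
      = (Ioo (1 : ℝ) 2).indicator (fun t => ENNReal.ofReal (t ^ n)) t *
        ∫⁻ r in Ioi (0 : ℝ), ENNReal.ofReal (Real.sinh r ^ (n - 1)) *
          F (Real.sinh r • (θ : EuclideanSpace ℝ (Fin n)), Real.cosh r) := by
    intro t ht
    have ht0 : 0 < t := ht
    have hFm : Measurable fun r : ℝ => ENNReal.ofReal (Real.sinh r ^ (n - 1)) *
        F (Real.sinh r • (θ : EuclideanSpace ℝ (Fin n)), Real.cosh r) := by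
      refine Measurable.mul (by fun_prop) (hF.comp ?_)
      fun_prop
    rw [← lintegral_const_mul _ hFm, ← lintegral_indicator measurableSet_Ioi]
    refine lintegral_congr fun r => ?_
    have hpt : ((t * Real.sinh r) • (θ : EuclideanSpace ℝ (Fin n)), t * Real.cosh r)
        = t • ((Real.sinh r • (θ : EuclideanSpace ℝ (Fin n)), Real.cosh r) : PseudoE n) := by
      rw [Prod.smul_mk, smul_smul, smul_eq_mul]
    by_cases hr : r ∈ Ioi (0 : ℝ)
    · have hs : 0 < Real.sinh r := Real.sinh_pos_iff.2 hr
      rw [indicator_of_mem hr]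
      simp only [g]
      rw [indicator_of_mem (show t * Real.sinh r ∈ Ioi (0 : ℝ) from mul_pos ht0 hs), hpt,
        coneLift_smul F (sphericalPoint_mem_hyp θ r) ht0]
      by_cases ht1 : t ∈ Ioo (1 : ℝ) 2
      · rw [indicator_of_mem ht1, if_pos (mem_Ioo.1 ht1), ← mul_assoc, ← mul_assoc,
          ← ENNReal.ofReal_mul ht0.le, ← ENNReal.ofReal_mul (by positivity)]
        congr 2
        obtain ⟨j, rfl⟩ : ∃ j, n = j + 1 := ⟨n - 1, by omega⟩
        simp only [Nat.add_sub_cancel]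
        ring
      · rw [indicator_of_notMem ht1, if_neg (mt mem_Ioo.2 ht1), mul_zero, mul_zero, zero_mul]
    · have hs : Real.sinh r ≤ 0 := Real.sinh_nonpos_iff.2 (not_lt.1 hr)
      rw [indicator_of_notMem hr]
      simp only [g]
      rw [indicator_of_notMem, mul_zero]
      exact not_lt.2 (mul_nonpos_of_nonneg_of_nonpos ht0.le hs)
  rw [hleft, lintegral_hyperbolicPolar g hg, setLIntegral_congr_fun measurableSet_Ioi hcore,
    lintegral_mul_const _ ((by fun_prop : Measurable fun t : ℝ => ENNReal.ofReal (t ^ n)).indicator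
      measurableSet_Ioo), lintegral_indicator measurableSet_Ioo, Measure.restrict_restrict
      measurableSet_Ioo, inter_eq_left.2 fun t ht => ?_]
  · rfl
  · exact zero_lt_one.trans ht.1

/-- The invariant measure of `ℍⁿ` is obtained from the Lebesgue measure of the light cone. -/
lemma lintegral_coneLift {n : ℕ} (hn : 1 ≤ n) {F : PseudoE n → ℝ≥0∞} (hF : Measurable F) :
    ∫⁻ Y, coneLift F Y = coneConst n * ∫⁻ x, F x ∂(hypMeasure n) := by
  have hL := measurable_coneLift hF
  have hm : Measurable fun q : (ℝ × USphere n) × ℝ => ENNReal.ofReal (q.2 ^ (n - 1)) *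
      coneLift F (q.2 • (q.1.2 : EuclideanSpace ℝ (Fin n)), q.1.1) := by
    have : Continuous fun q : (ℝ × USphere n) × ℝ =>
      ((q.2 • (q.1.2 : EuclideanSpace ℝ (Fin n)), q.1.1) : PseudoE n) := by fun_prop
    exact Measurable.mul (by fun_prop) (hL.comp this.measurable)
  have hFm : Measurable fun q : USphere n × ℝ => ENNReal.ofReal (Real.sinh q.2 ^ (n - 1)) *
        F (Real.sinh q.2 • (q.1 : EuclideanSpace ℝ (Fin n)), Real.cosh q.2) := by
    have : Continuous fun q : USphere n × ℝ =>
      ((Real.sinh q.2 • (q.1 : EuclideanSpace ℝ (Fin n)), Real.cosh q.2) : PseudoE n) := by fun_prop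
    exact Measurable.mul (by fun_prop) (hF.comp this.measurable)
  rw [Measure.volume_eq_prod, lintegral_prod_symm _ hL.aemeasurable]
  have h1 : ∀ y : ℝ, ∫⁻ x : EuclideanSpace ℝ (Fin n), coneLift F (x, y) = _ := fun y =>
    lintegral_polar hn (fun x => coneLift F (x, y)) (hL.comp measurable_prodMk_right)
  simp_rw [h1]
  rw [lintegral_lintegral_swap (Measurable.lintegral_prod_right' hm).aemeasurable,
    lintegral_hypMeasure hF, ← lintegral_const_mul _ (Measurable.lintegral_prod_right' hFm)]
  exact lintegral_congr fun θ => lintegral_coneLift_ray hn hF θ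

/-! ### Integrals over hyperplanes of pseudo-Euclidean space -/

/-- An isometry `U × V → W` of Euclidean spaces of equal dimension, extended by the identity on the
time axis, preserves the volume. -/
lemma measurePreserving_prodMap_of_norm_sq {U V W : Type*}
    [NormedAddCommGroup U] [InnerProductSpace ℝ U] [MeasurableSpace U] [BorelSpace U]
    [FiniteDimensional ℝ U]
    [NormedAddCommGroup V] [InnerProductSpace ℝ V] [MeasurableSpace V] [BorelSpace V]
    [FiniteDimensional ℝ V]
    [NormedAddCommGroup W] [InnerProductSpace ℝ W] [MeasurableSpace W] [BorelSpace W]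
    [FiniteDimensional ℝ W]
    (f : U × V →ₗ[ℝ] W) (hf : ∀ x, ‖f x‖ ^ 2 = ‖x.1‖ ^ 2 + ‖x.2‖ ^ 2)
    (hd : Module.finrank ℝ U + Module.finrank ℝ V = Module.finrank ℝ W) :
    MeasurePreserving fun q : U × V × ℝ => (f (q.1, q.2.1), q.2.2) := by
  have h1 := (measurePreserving_of_norm_sq f hf hd).prod (MeasurePreserving.id (volume : Measure ℝ))
  have h2 : MeasurePreserving (MeasurableEquiv.prodAssoc (α := U) (β := V) (γ := ℝ)).symm :=
    volume_preserving_prodAssoc.symm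
  exact h1.comp h2

/-- The vector of `ℝ^{k+1}` with first coordinate `s` and last `k` coordinates `b`. -/
def consMap (k : ℕ) : ℝ × EuclideanSpace ℝ (Fin k) →ₗ[ℝ] EuclideanSpace ℝ (Fin (k + 1)) where
  toFun q := WithLp.toLp 2 (Fin.cons q.1 q.2.ofLp)
  map_add' x y := by
    ext i
    refine Fin.cases ?_ (fun j => ?_) i <;> simp
  map_smul' c x := by
    ext i
    refine Fin.cases ?_ (fun j => ?_) i <;> simp

lemma consMap_norm_sq {k : ℕ} (q : ℝ × EuclideanSpace ℝ (Fin k)) :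
    ‖consMap k q‖ ^ 2 = ‖q.1‖ ^ 2 + ‖q.2‖ ^ 2 := by
  rw [EuclideanSpace.norm_sq_eq, EuclideanSpace.norm_sq_eq, Fin.sum_univ_succ]
  simp [consMap]

lemma measurePreserving_consMap (k : ℕ) :
    MeasurePreserving fun q : ℝ × PseudoE k => ((consMap k (q.1, q.2.1), q.2.2) : PseudoE (k + 1)) :=
  measurePreserving_prodMap_of_norm_sq (consMap k) consMap_norm_sq (by simp [add_comm])

/-- The last `k + 1` coordinates of a vector of `𝔼^{k+1,1}`. -/
def tailPart (k : ℕ) : PseudoE (k + 1) →ₗ[ℝ] PseudoE k where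
  toFun η := (WithLp.toLp 2 fun i : Fin k => η.1 i.succ, η.2)
  map_add' _ _ := rfl
  map_smul' _ _ := rfl

/-- The first coordinate of a vector of `𝔼^{k+1,1}`. -/
def headCoord (k : ℕ) : PseudoE (k + 1) →ₗ[ℝ] ℝ where
  toFun η := η.1 0
  map_add' _ _ := rfl
  map_smul' _ _ := rfl

lemma form_eq_headCoord_tailPart {k : ℕ} (η : PseudoE (k + 1)) :
    form η η = form (tailPart k η) (tailPart k η) - headCoord k η ^ 2 := by
  have h1 : tailPart k η = (WithLp.toLp 2 fun i : Fin k => η.1 i.succ, η.2) := rfl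
  have h2 : headCoord k η = η.1 0 := rfl
  rw [h1, h2, form, form, Fin.sum_univ_succ]
  ring

/-- The decomposition of `𝔼^{k+1,1}` into a spacelike line and its orthogonal complement preserves
the volume. -/
lemma measurePreserving_add_hyperplane {k : ℕ} {w : PseudoE (k + 1)} (hw : form w w = -1)
    (T : PseudoE k →ₗ[ℝ] PseudoE (k + 1)) (hT : ∀ Z, form (T Z) (T Z) = form Z Z)
    (hTw : ∀ Z, form (T Z) w = 0) :
    MeasurePreserving fun q : ℝ × PseudoE k => q.1 • w + T q.2 := by
  -- Sending the first coordinate vector to `w` and the remaining coordinates through `T` gives a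
  -- form-preserving endomorphism: both directions have form `-1` and both complements are isometric
  -- copies of `𝔼^{k,1}`.
  let A : PseudoE (k + 1) →ₗ[ℝ] PseudoE (k + 1) :=
    (headCoord k).smulRight w + T ∘ₗ tailPart k
  have hA : ∀ η, A η = headCoord k η • w + T (tailPart k η) := fun _ => rfl
  have hform : ∀ η, form (A η) (A η) = form η η := by
    intro η
    rw [hA, form_add_left, form_comm _ (_ + _), form_comm _ (_ + _), form_add_left, form_add_left,
      form_smul_smul, hw, hT, form_smul_left, form_comm w, hTw, form_comm _ (_ • w),
      form_smul_left, form_comm w, hTw, form_eq_headCoord_tailPart]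
    ring
  exact (measurePreserving_of_form A hform).comp (measurePreserving_consMap k)

/-- The Lebesgue integral of `Φ` over the hyperplane `w^⊥`, written as an integral over a strip by
means of the pseudo-orthogonal projection `η ↦ η + [η, w] w`. -/
def hyperplaneIntegral {n : ℕ} (Φ : PseudoE n → ℝ≥0∞) (w : PseudoE n) : ℝ≥0∞ :=
  ∫⁻ η, (Icc (0 : ℝ) 1).indicator 1 (form η w) * Φ (η + form η w • w)

/-- This is the purpose of the strip: the integrand depends explicitly on `w`, with no choice of a
basis of `w^⊥`, so measurability in the parameters follows from Tonelli. -/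
lemma measurable_hyperplaneIntegral {n : ℕ} {α : Type*} [MeasurableSpace α]
    {Φ : α → PseudoE n → ℝ≥0∞} (hΦ : Measurable (Function.uncurry Φ)) {w : α → PseudoE n}
    (hw : Measurable w) : Measurable fun a => hyperplaneIntegral (Φ a) (w a) := by
  have hf : Measurable fun q : α × PseudoE n => form q.2 (w q.1) :=
    measurable_form measurable_snd (hw.comp measurable_fst)
  refine Measurable.lintegral_prod_right' (f := fun q : α × PseudoE n =>
    (Icc (0 : ℝ) 1).indicator 1 (form q.2 (w q.1)) *
      Φ q.1 (q.2 + form q.2 (w q.1) • w q.1)) ?_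
  refine Measurable.mul ((measurable_one.indicator measurableSet_Icc).comp hf) ?_
  exact hΦ.comp (measurable_fst.prodMk (measurable_snd.add (hf.smul (hw.comp measurable_fst))))

/-- The strip integral is the integral over the hyperplane in any isometric parametrization. -/
lemma hyperplaneIntegral_eq {k : ℕ} {Φ : PseudoE (k + 1) → ℝ≥0∞} (hΦ : Measurable Φ)
    {w : PseudoE (k + 1)} (hw : form w w = -1)
    (T : PseudoE k →ₗ[ℝ] PseudoE (k + 1)) (hT : ∀ Z, form (T Z) (T Z) = form Z Z)
    (hTw : ∀ Z, form (T Z) w = 0) :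
    hyperplaneIntegral Φ w = ∫⁻ Z, Φ (T Z) := by
  have hm : Measurable fun η : PseudoE (k + 1) => form η w :=
    measurable_form measurable_id measurable_const
  have hT' : Measurable T := (LinearMap.continuous_of_finiteDimensional T).measurable
  have hmeas : Measurable fun η : PseudoE (k + 1) =>
      (Icc (0 : ℝ) 1).indicator 1 (form η w) * Φ (η + form η w • w) := by
    refine Measurable.mul ((measurable_one.indicator measurableSet_Icc).comp hm) (hΦ.comp ?_)
    exact measurable_id.add (hm.smul measurable_const)
  have hpt : ∀ q : ℝ × PseudoE k, form (q.1 • w + T q.2) w = -q.1 := by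
    intro q
    rw [form_add_left, form_smul_left, hw, hTw]
    ring
  -- The strip has unit width along `w`; the sign comes from `[w, w] = -1`.
  have hI : ∫⁻ s : ℝ, (Icc (0 : ℝ) 1).indicator (1 : ℝ → ℝ≥0∞) (-s) = 1 := by
    have : ∀ s : ℝ, (Icc (0 : ℝ) 1).indicator (1 : ℝ → ℝ≥0∞) (-s)
        = (Icc (-1 : ℝ) 0).indicator 1 s := by
      intro s
      have : -s ∈ Icc (0 : ℝ) 1 ↔ s ∈ Icc (-1 : ℝ) 0 := by
        simp only [mem_Icc]
        constructor <;> rintro ⟨h1, h2⟩ <;> constructor <;> linarith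
      by_cases hs : s ∈ Icc (-1 : ℝ) 0
      · rw [indicator_of_mem hs, indicator_of_mem (this.2 hs)]
        rfl
      · rw [indicator_of_notMem hs, indicator_of_notMem (mt this.1 hs)]
    simp_rw [this]
    rw [lintegral_indicator_one measurableSet_Icc, Real.volume_Icc]
    norm_num
  calc hyperplaneIntegral Φ w
      = ∫⁻ q : ℝ × PseudoE k, (Icc (0 : ℝ) 1).indicator (1 : ℝ → ℝ≥0∞) (-q.1) * Φ (T q.2) := by
        rw [hyperplaneIntegral,
          ← (measurePreserving_add_hyperplane hw T hT hTw).lintegral_comp hmeas]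
        refine lintegral_congr fun q => ?_
        rw [hpt]
        congr 2
        module
    _ = (∫⁻ s : ℝ, (Icc (0 : ℝ) 1).indicator (1 : ℝ → ℝ≥0∞) (-s)) * ∫⁻ Z, Φ (T Z) := by
        rw [Measure.volume_eq_prod]
        refine lintegral_prod_mul (f := fun s : ℝ => (Icc (0 : ℝ) 1).indicator (1 : ℝ → ℝ≥0∞) (-s))
          (g := fun Z => Φ (T Z)) ?_ (hΦ.comp hT').aemeasurable
        exact ((measurable_one.indicator measurableSet_Icc).comp measurable_neg).aemeasurable
    _ = ∫⁻ Z, Φ (T Z) := by rw [hI, one_mul]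

/-- The orthogonal complement of a unit vector of `ℝ^{k+1}` is isometric to `ℝ^k`. -/
lemma exists_isometry_orthogonal {k : ℕ} (σ : USphere (k + 1)) :
    ∃ J : EuclideanSpace ℝ (Fin k) →ₗᵢ[ℝ] EuclideanSpace ℝ (Fin (k + 1)),
      ∀ z, inner ℝ (σ : EuclideanSpace ℝ (Fin (k + 1))) (J z) = (0 : ℝ) := by
  have hσ0 : (σ : EuclideanSpace ℝ (Fin (k + 1))) ≠ 0 := ne_zero_of_mem_unit_sphere σ
  let W : Submodule ℝ (EuclideanSpace ℝ (Fin (k + 1))) :=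
    (Submodule.span ℝ {(σ : EuclideanSpace ℝ (Fin (k + 1)))})ᗮ
  have : Fact (Module.finrank ℝ (EuclideanSpace ℝ (Fin (k + 1))) = k + 1) := ⟨by simp⟩
  have hW : Module.finrank ℝ W = k := Submodule.finrank_orthogonal_span_singleton hσ0
  let e : EuclideanSpace ℝ (Fin k) ≃ₗᵢ[ℝ] W :=
    ((stdOrthonormalBasis ℝ W).reindex (finCongr hW)).repr.symm
  exact ⟨W.subtypeₗᵢ.comp e.toLinearIsometry, fun z =>
    Submodule.mem_orthogonal_singleton_iff_inner_right.1 (e z).2⟩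

/-- For a fixed direction `σ` the hyperplanes orthogonal to `σ cosh ρ + e sinh ρ`, `ρ ∈ ℝ`, foliate
the light cone. -/
lemma lintegral_hyperplaneIntegral_le {k : ℕ} {Φ : PseudoE (k + 1) → ℝ≥0∞} (hΦ : Measurable Φ)
    (hΦ0 : ∀ η, η.2 ≤ 0 → Φ η = 0) (σ : USphere (k + 1)) :
    ∫⁻ ρ : ℝ, (ENNReal.ofReal (Real.cosh ρ))⁻¹ * hyperplaneIntegral Φ
        (Real.cosh ρ • (σ : EuclideanSpace ℝ (Fin (k + 1))), Real.sinh ρ)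
      ≤ ∫⁻ η, Φ η / ENNReal.ofReal η.2 := by
  obtain ⟨J, hJ⟩ := exists_isometry_orthogonal σ
  obtain ⟨σ, hσ⟩ := σ
  simp only at hJ ⊢
  have hσσ : inner ℝ σ σ = (1 : ℝ) := by
    rw [real_inner_self_eq_norm_sq, mem_sphere_zero_iff_norm.1 hσ, one_pow]
  have hJ' : ∀ z, inner ℝ (J z) σ = (0 : ℝ) := fun z => by rw [real_inner_comm, hJ]
  have hJc : Continuous J := J.continuous
  -- the hyperplane orthogonal to the point with parameter `ρ`
  have hH : ∀ ρ : ℝ, hyperplaneIntegral Φ (Real.cosh ρ • σ, Real.sinh ρ)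
      = ∫⁻ Z : PseudoE k, Φ (J Z.1 + (Z.2 * Real.sinh ρ) • σ, Z.2 * Real.cosh ρ) := by
    intro ρ
    -- The hyperplane `w^⊥` is spanned by `σ^⊥` in the spatial part, parametrized by `J`, and by the
    -- unit timelike vector `σ sinh ρ + e cosh ρ`.
    let T : PseudoE k →ₗ[ℝ] PseudoE (k + 1) :=
      { toFun := fun Z => (J Z.1 + (Z.2 * Real.sinh ρ) • σ, Z.2 * Real.cosh ρ)
        map_add' := fun x y => by
          ext1
          · simp only [Prod.fst_add, Prod.snd_add, map_add]; module
          · simp only [Prod.snd_add]; ring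
        map_smul' := fun c x => by
          ext1
          · simp only [Prod.smul_fst, Prod.smul_snd, map_smul, RingHom.id_apply, smul_eq_mul]
            module
          · simp only [Prod.smul_snd, RingHom.id_apply, smul_eq_mul]; ring }
    have hTa : ∀ Z, T Z = (J Z.1 + (Z.2 * Real.sinh ρ) • σ, Z.2 * Real.cosh ρ) := fun _ => rfl
    refine hyperplaneIntegral_eq hΦ ?_ T (fun Z => ?_) (fun Z => ?_)
    · rw [form_eq, inner_smul_left, inner_smul_right, hσσ, conj_trivial]
      linear_combination -Real.cosh_sq ρ
    · rw [hTa, form_eq, form_eq, inner_add_left, inner_add_right, inner_add_right, inner_smul_left,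
        inner_smul_left, inner_smul_right, inner_smul_right, hσσ, hJ, hJ', J.inner_map_map,
        conj_trivial]
      linear_combination Z.2 ^ 2 * Real.cosh_sq ρ
    · rw [hTa, form_eq, inner_add_left, inner_smul_left, inner_smul_right, inner_smul_right, hσσ,
        hJ', conj_trivial]
      ring
  let g : EuclideanSpace ℝ (Fin k) → ℝ → ℝ → ℝ≥0∞ := fun z s y =>
    Φ (J z + s • σ, y) / ENNReal.ofReal y
  have hgm : Measurable fun q : (EuclideanSpace ℝ (Fin k) × ℝ) × ℝ => g q.1.1 q.1.2 q.2 := by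
    have hc : Continuous fun q : (EuclideanSpace ℝ (Fin k) × ℝ) × ℝ =>
        ((J q.1.1 + q.1.2 • σ, q.2) : PseudoE (k + 1)) := by fun_prop
    exact (hΦ.comp hc.measurable).div (by fun_prop)
  have hΨ : Measurable fun q : (ℝ × EuclideanSpace ℝ (Fin k)) × ℝ =>
      (ENNReal.ofReal (Real.cosh q.1.1))⁻¹ *
        Φ (J q.1.2 + (q.2 * Real.sinh q.1.1) • σ, q.2 * Real.cosh q.1.1) := by
    have hc : Continuous fun q : (ℝ × EuclideanSpace ℝ (Fin k)) × ℝ =>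
        ((J q.1.2 + (q.2 * Real.sinh q.1.1) • σ, q.2 * Real.cosh q.1.1) : PseudoE (k + 1)) := by
      fun_prop
    exact Measurable.mul (by fun_prop) (hΦ.comp hc.measurable)
  -- At a fixed component `z` in `σ^⊥`, the pair `(t, ρ)` is a system of hyperbolic polar
  -- coordinates in the plane of `σ` and the time axis. Dividing `Φ` by `y = t cosh ρ` and
  -- multiplying by the Jacobian `t` leaves exactly `(cosh ρ)⁻¹`. The inequality comes from
  -- enlarging the forward cone `|s| < y` to the whole plane.
  have hplane : ∀ z, ∫⁻ ρ : ℝ, ∫⁻ t : ℝ, (ENNReal.ofReal (Real.cosh ρ))⁻¹ *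
        Φ (J z + (t * Real.sinh ρ) • σ, t * Real.cosh ρ)
      ≤ ∫⁻ y : ℝ, ∫⁻ s : ℝ, g z s y := by
    intro z
    have hgz : Measurable (Function.uncurry (g z)) :=
      hgm.comp ((measurable_const.prodMk measurable_fst).prodMk measurable_snd)
    rw [lintegral_lintegral_swap (by
      exact (hΨ.comp ((measurable_fst.prodMk measurable_const).prodMk
        measurable_snd)).aemeasurable)]
    calc ∫⁻ t : ℝ, ∫⁻ ρ : ℝ, (ENNReal.ofReal (Real.cosh ρ))⁻¹ *
          Φ (J z + (t * Real.sinh ρ) • σ, t * Real.cosh ρ)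
        = ∫⁻ t in Ioi (0 : ℝ), ∫⁻ ρ : ℝ,
          ENNReal.ofReal t * g z (t * Real.sinh ρ) (t * Real.cosh ρ) := by
          rw [← lintegral_indicator measurableSet_Ioi]
          refine lintegral_congr fun t => ?_
          by_cases ht : t ∈ Ioi (0 : ℝ)
          · rw [indicator_of_mem ht]
            refine lintegral_congr fun ρ => ?_
            have h0 : ENNReal.ofReal t ≠ 0 := (ENNReal.ofReal_pos.2 ht).ne'
            have ht' : (0 : ℝ) < t := ht
            simp only [g]
            rw [ENNReal.ofReal_mul ht'.le, ENNReal.div_eq_inv_mul,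
              ENNReal.mul_inv (Or.inl h0) (Or.inl ENNReal.ofReal_ne_top), ← mul_assoc, ← mul_assoc,
              ENNReal.mul_inv_cancel h0 ENNReal.ofReal_ne_top, one_mul]
          · rw [indicator_of_notMem ht]
            refine (lintegral_congr fun ρ => ?_).trans lintegral_zero
            rw [hΦ0 _ (mul_nonpos_of_nonpos_of_nonneg (not_lt.1 ht) (Real.cosh_pos ρ).le), mul_zero]
      _ = ∫⁻ y in Ioi (0 : ℝ), ∫⁻ s in Ioo (-y) y, g z s y :=
          (lintegral_hyperbolicPolar (g z) hgz).symm
      _ ≤ ∫⁻ y in Ioi (0 : ℝ), ∫⁻ s : ℝ, g z s y :=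
          lintegral_mono fun y => setLIntegral_le_lintegral _ _
      _ ≤ ∫⁻ y : ℝ, ∫⁻ s : ℝ, g z s y := setLIntegral_le_lintegral _ _
  let f : ℝ × EuclideanSpace ℝ (Fin k) →ₗ[ℝ] EuclideanSpace ℝ (Fin (k + 1)) :=
    LinearMap.coprod (LinearMap.toSpanSingleton ℝ _ σ) J.toLinearMap
  have hfa : ∀ q, f q = q.1 • σ + J q.2 := fun _ => rfl
  have hfn : ∀ q, ‖f q‖ ^ 2 = ‖q.1‖ ^ 2 + ‖q.2‖ ^ 2 := by
    intro q
    rw [hfa, ← real_inner_self_eq_norm_sq, inner_add_left, inner_add_right, inner_add_right,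
      inner_smul_left, inner_smul_left, inner_smul_right, inner_smul_right, hσσ, hJ, hJ',
      J.inner_map_map, real_inner_self_eq_norm_sq, conj_trivial, Real.norm_eq_abs, sq_abs]
    ring
  have hpres := measurePreserving_prodMap_of_norm_sq f hfn (by simp [add_comm])
  calc ∫⁻ ρ : ℝ, (ENNReal.ofReal (Real.cosh ρ))⁻¹ *
        hyperplaneIntegral Φ (Real.cosh ρ • σ, Real.sinh ρ)
      = ∫⁻ ρ : ℝ, ∫⁻ z, ∫⁻ t : ℝ, (ENNReal.ofReal (Real.cosh ρ))⁻¹ *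
          Φ (J z + (t * Real.sinh ρ) • σ, t * Real.cosh ρ) := by
        refine lintegral_congr fun ρ => ?_
        have hρ : Measurable fun Z : PseudoE k =>
            Φ (J Z.1 + (Z.2 * Real.sinh ρ) • σ, Z.2 * Real.cosh ρ) := by
          have hc : Continuous fun Z : PseudoE k =>
            ((J Z.1 + (Z.2 * Real.sinh ρ) • σ, Z.2 * Real.cosh ρ) : PseudoE (k + 1)) := by fun_prop
          exact hΦ.comp hc.measurable
        rw [hH, ← lintegral_const_mul _ hρ, Measure.volume_eq_prod,
          lintegral_prod _ (hρ.const_mul _).aemeasurable]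
    _ = ∫⁻ z, ∫⁻ ρ : ℝ, ∫⁻ t : ℝ, (ENNReal.ofReal (Real.cosh ρ))⁻¹ *
          Φ (J z + (t * Real.sinh ρ) • σ, t * Real.cosh ρ) :=
        lintegral_lintegral_swap (Measurable.lintegral_prod_right' hΨ).aemeasurable
    _ ≤ ∫⁻ z, ∫⁻ y : ℝ, ∫⁻ s : ℝ, g z s y := lintegral_mono hplane
    _ = ∫⁻ q : ℝ × EuclideanSpace ℝ (Fin k) × ℝ, g q.2.1 q.1 q.2.2 := by
        have hq : Measurable fun q : ℝ × EuclideanSpace ℝ (Fin k) × ℝ => g q.2.1 q.1 q.2.2 :=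
          hgm.comp (((measurable_fst.comp measurable_snd).prodMk measurable_fst).prodMk
            (measurable_snd.comp measurable_snd))
        rw [Measure.volume_eq_prod, lintegral_prod_symm _ hq.aemeasurable, Measure.volume_eq_prod,
          lintegral_prod _ (Measurable.lintegral_prod_left' hq).aemeasurable]
    _ = ∫⁻ η, Φ η / ENNReal.ofReal η.2 := by
        rw [← hpres.lintegral_comp (f := fun η : PseudoE (k + 1) => Φ η / ENNReal.ofReal η.2)
          (hΦ.div (by fun_prop))]
        refine lintegral_congr fun q => ?_
        simp only [g]
        rw [hfa, add_comm (J _)]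

/-! ### Averaging over the slices -/

/-- `join` as a linear map. -/
def joinMap (m k : ℕ) : EuclideanSpace ℝ (Fin m) × EuclideanSpace ℝ (Fin k) →ₗ[ℝ]
    EuclideanSpace ℝ (Fin (m + k)) where
  toFun q := join q.1 q.2
  map_add' _ _ := join_add _ _ _ _
  map_smul' _ _ := join_smul _ _ _

lemma joinMap_norm_sq {m k : ℕ} (q : EuclideanSpace ℝ (Fin m) × EuclideanSpace ℝ (Fin k)) :
    ‖joinMap m k q‖ ^ 2 = ‖q.1‖ ^ 2 + ‖q.2‖ ^ 2 := by
  change ‖join q.1 q.2‖ ^ 2 = _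
  rw [← real_inner_self_eq_norm_sq, inner_join, real_inner_self_eq_norm_sq,
    real_inner_self_eq_norm_sq]

lemma continuous_join {m k : ℕ} :
    Continuous fun q : EuclideanSpace ℝ (Fin m) × EuclideanSpace ℝ (Fin k) => join q.1 q.2 :=
  LinearMap.continuous_of_finiteDimensional (joinMap m k)

lemma headPart_join {m k : ℕ} (a : EuclideanSpace ℝ (Fin m)) (b : EuclideanSpace ℝ (Fin k))
    (y : ℝ) : headPart m k (join a b, y) = a := by
  ext i
  simp [headPart, join]

lemma measurable_headPart (m k : ℕ) : Measurable (headPart m k) := by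
  have : Continuous (headPart m k) := by
    unfold headPart
    fun_prop
  exact this.measurable

lemma lintegral_join {m k : ℕ} {Φ : PseudoE (m + k) → ℝ≥0∞} (hΦ : Measurable Φ) :
    ∫⁻ Y, Φ Y = ∫⁻ a : EuclideanSpace ℝ (Fin m), ∫⁻ Z : PseudoE k, Φ (join a Z.1, Z.2) := by
  have h := measurePreserving_prodMap_of_norm_sq (joinMap m k) joinMap_norm_sq (by simp)
  rw [← h.lintegral_comp hΦ, Measure.volume_eq_prod]
  exact lintegral_prod _ (hΦ.comp h.measurable).aemeasurable

lemma lintegral_sliceIncl {m k : ℕ} {Φ : PseudoE (m + k) → ℝ≥0∞} (hΦ : Measurable Φ)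
    (v : EuclideanSpace ℝ (Fin m)) :
    ∫⁻ η, Φ (sliceIncl m k v η) = ∫⁻ s : ℝ, ∫⁻ Z : PseudoE k, Φ (join (s • v) Z.1, Z.2) := by
  have hs : Continuous (sliceIncl m k v) := by
    unfold sliceIncl
    exact (continuous_join.comp (f := fun η : PseudoE (k + 1) =>
      (η.1 0 • v, WithLp.toLp 2 fun i : Fin k => η.1 i.succ)) (by fun_prop)).prodMk continuous_snd
  have h := measurePreserving_consMap k
  refine (h.lintegral_comp (hΦ.comp hs.measurable)).symm.trans ?_
  rw [Measure.volume_eq_prod]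
  exact lintegral_prod _ ((hΦ.comp hs.measurable).comp h.measurable).aemeasurable

/-- The weight cancels the polar Jacobian `s^{m-1}`. -/
lemma lintegral_div_norm_pow {m : ℕ} (hm : 1 ≤ m) {G : EuclideanSpace ℝ (Fin m) → ℝ≥0∞}
    (hG : Measurable G) :
    ∫⁻ a, G a / ‖a‖ₑ ^ (m - 1) = ∫⁻ v, (∫⁻ s in Ioi (0 : ℝ),
      G (s • (v : EuclideanSpace ℝ (Fin m)))) ∂(sphereMeasure m) := by
  rw [lintegral_polar hm (fun a => G a / ‖a‖ₑ ^ (m - 1)) (hG.div (by fun_prop))]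
  refine lintegral_congr fun v => setLIntegral_congr_fun measurableSet_Ioi fun s hs => ?_
  have hs0 : (0 : ℝ) < s := hs
  have hn : ‖s • (v : EuclideanSpace ℝ (Fin m))‖ₑ = ENNReal.ofReal s := by
    rw [← ofReal_norm, norm_smul, mem_sphere_zero_iff_norm.1 v.2, mul_one, Real.norm_of_nonneg hs0.le]
  have h0 : ENNReal.ofReal s ^ (m - 1) ≠ 0 := pow_ne_zero _ (ENNReal.ofReal_pos.2 hs0).ne'
  have h1 : ENNReal.ofReal s ^ (m - 1) ≠ ∞ := ENNReal.pow_ne_top ENNReal.ofReal_ne_top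
  rw [hn, ENNReal.ofReal_pow hs0.le, ENNReal.mul_div_cancel h0 h1]

/-- A slice contains the full line `ℝ v`, while polar coordinates see only a ray. The two half-lines
account for the factor 2 in the averaging formula. -/
lemma lintegral_eq_add_lintegral_neg (g : ℝ → ℝ≥0∞) :
    ∫⁻ s, g s = (∫⁻ s in Ioi (0 : ℝ), g s) + ∫⁻ s in Ioi (0 : ℝ), g (-s) := by
  have h : ∫⁻ s in Ioi (0 : ℝ), g (-s) = ∫⁻ s in Iio (0 : ℝ), g s := by
    have := (Measure.measurePreserving_neg (volume : Measure ℝ)).setLIntegral_comp_preimage_emb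
      (MeasurableEquiv.neg ℝ).measurableEmbedding g (Iio 0)
    simpa using this
  rw [h, ← lintegral_add_compl g measurableSet_Ioi, compl_Ioi, setLIntegral_congr Iio_ae_eq_Iic]

/-- Integration over all slices `ℝ_v^{k+2}` is integration with the weight `2 |x'|^{1-m}`. -/
lemma lintegral_lintegral_sliceIncl {m k : ℕ} (hm : 1 ≤ m) {Φ : PseudoE (m + k) → ℝ≥0∞}
    (hΦ : Measurable Φ) :
    ∫⁻ v, (∫⁻ η, Φ (sliceIncl m k (v : EuclideanSpace ℝ (Fin m)) η)) ∂(sphereMeasure m)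
      = 2 * ∫⁻ Y, Φ Y / ‖headPart m k Y‖ₑ ^ (m - 1) := by
  let G : EuclideanSpace ℝ (Fin m) → ℝ≥0∞ := fun a => ∫⁻ Z : PseudoE k, Φ (join a Z.1, Z.2)
  have hjm : Measurable fun q : EuclideanSpace ℝ (Fin m) × PseudoE k =>
      ((join q.1 q.2.1, q.2.2) : PseudoE (m + k)) := by
    have : Continuous fun q : EuclideanSpace ℝ (Fin m) × PseudoE k =>
        ((join q.1 q.2.1, q.2.2) : PseudoE (m + k)) :=
      (continuous_join.comp (f := fun q : EuclideanSpace ℝ (Fin m) × PseudoE k =>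
        (q.1, q.2.1)) (by fun_prop)).prodMk (by fun_prop)
    exact this.measurable
  have hG : Measurable G := Measurable.lintegral_prod_right' (hΦ.comp hjm)
  have hGn : Measurable fun a => G (-a) := hG.comp measurable_neg
  have hright : ∫⁻ Y, Φ Y / ‖headPart m k Y‖ₑ ^ (m - 1) = ∫⁻ a, G a / ‖a‖ₑ ^ (m - 1) := by
    rw [lintegral_join (Φ := fun Y => Φ Y / ‖headPart m k Y‖ₑ ^ (m - 1)) (hΦ.div ((measurable_headPart m k).enorm.pow_const _))]
    refine lintegral_congr fun a => ?_
    simp only [headPart_join, G, div_eq_mul_inv]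
    exact lintegral_mul_const _ (hΦ.comp (hjm.comp (measurable_prodMk_left (x := a))))
  have hneg : ∫⁻ a, G (-a) / ‖a‖ₑ ^ (m - 1) = ∫⁻ a, G a / ‖a‖ₑ ^ (m - 1) := by
    have := lintegral_neg_eq_self (μ := (volume : Measure (EuclideanSpace ℝ (Fin m))))
      (fun a => G a / ‖a‖ₑ ^ (m - 1))
    simpa only [enorm_neg] using this
  have hpos : Measurable fun v : USphere m => ∫⁻ s in Ioi (0 : ℝ),
      G (s • (v : EuclideanSpace ℝ (Fin m))) := by
    refine Measurable.lintegral_prod_right' (f := fun q : USphere m × ℝ =>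
      G (q.2 • (q.1 : EuclideanSpace ℝ (Fin m)))) (hG.comp ?_)
    exact measurable_snd.smul (measurable_subtype_coe.comp measurable_fst)
  calc ∫⁻ v, (∫⁻ η, Φ (sliceIncl m k (v : EuclideanSpace ℝ (Fin m)) η)) ∂(sphereMeasure m)
      = ∫⁻ v, ((∫⁻ s in Ioi (0 : ℝ), G (s • (v : EuclideanSpace ℝ (Fin m)))) +
          ∫⁻ s in Ioi (0 : ℝ), G (-(s • (v : EuclideanSpace ℝ (Fin m))))) ∂(sphereMeasure m) := by
        refine lintegral_congr fun v => ?_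
        rw [lintegral_sliceIncl hΦ, lintegral_eq_add_lintegral_neg]
        simp only [neg_smul]
        rfl
    _ = 2 * ∫⁻ Y, Φ Y / ‖headPart m k Y‖ₑ ^ (m - 1) := by
        rw [lintegral_add_left hpos, ← lintegral_div_norm_pow hm hG,
          ← lintegral_div_norm_pow hm hGn, hneg, hright, two_mul]

/-! ### Hölder's inequality on the light cone -/

lemma lintegral_exp_neg_lt_top {b : ℝ} (hb : 0 < b) (c : ℝ) :
    ∫⁻ r in Ioi (0 : ℝ), ENNReal.ofReal (c * Real.exp (-b * r)) < ∞ :=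
  ((exp_neg_integrableOn_Ioi 0 hb).const_mul c).lintegral_lt_top

/-- The function `x_{n+1}^{-q}` is integrable on `ℍ^{k+1}` for `q > k`. -/
lemma lintegral_hypMeasure_rpow_lt_top {k : ℕ} {q : ℝ} (hq : (k : ℝ) < q) :
    ∫⁻ x, (ENNReal.ofReal x.2)⁻¹ ^ q ∂(hypMeasure (k + 1)) < ∞ := by
  have hq0 : 0 < q := lt_of_le_of_lt (Nat.cast_nonneg k) hq
  rw [lintegral_hypMeasure (F := fun x => (ENNReal.ofReal x.2)⁻¹ ^ q) (by fun_prop)]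
  have hle : ∀ r ∈ Ioi (0 : ℝ), ENNReal.ofReal (Real.sinh r ^ (k + 1 - 1)) *
      (ENNReal.ofReal (Real.cosh r))⁻¹ ^ q
      ≤ ENNReal.ofReal (2 ^ (q - k) * Real.exp (-(q - k) * r)) := by
    intro r hr
    have hc := Real.cosh_pos r
    have hs : 0 < Real.sinh r := Real.sinh_pos_iff.2 hr
    rw [Nat.add_sub_cancel, ENNReal.inv_rpow, ENNReal.ofReal_rpow_of_pos hc,
      ← ENNReal.ofReal_inv_of_pos (Real.rpow_pos_of_pos hc _), ← ENNReal.ofReal_mul (by positivity)]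
    refine ENNReal.ofReal_le_ofReal ?_
    have h1 : Real.sinh r ^ k ≤ Real.cosh r ^ k :=
      pow_le_pow_left₀ hs.le (Real.sinh_lt_cosh r).le k
    have h2 : Real.exp r / 2 ≤ Real.cosh r := by
      rw [Real.cosh_eq]
      linarith [Real.exp_pos (-r)]
    have he : 0 < Real.exp r / 2 := by positivity
    -- The surplus `q - k > 0` of decay over the volume growth `sinh^k r` leaves an integrable
    -- exponential.
    calc Real.sinh r ^ k * (Real.cosh r ^ q)⁻¹ ≤ Real.cosh r ^ k * (Real.cosh r ^ q)⁻¹ := by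
          gcongr
      _ = Real.cosh r ^ (-(q - k)) := by
          rw [← Real.rpow_natCast, ← Real.rpow_neg hc.le, ← Real.rpow_add hc]
          congr 1
          ring
      _ ≤ (Real.exp r / 2) ^ (-(q - k)) :=
          Real.rpow_le_rpow_of_nonpos he h2 (by linarith)
      _ = 2 ^ (q - k) * Real.exp (-(q - k) * r) := by
          rw [Real.div_rpow (Real.exp_pos r).le zero_le_two, ← Real.exp_mul, Real.rpow_neg zero_le_two,
            div_inv_eq_mul, mul_comm, mul_comm r]
  calc _ ≤ ∫⁻ _, (∫⁻ r in Ioi (0 : ℝ),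
        ENNReal.ofReal (2 ^ (q - k) * Real.exp (-(q - k) * r))) ∂(sphereMeasure (k + 1)) :=
        lintegral_mono fun θ => setLIntegral_mono' measurableSet_Ioi hle
    _ < ∞ := by
        rw [lintegral_const]
        exact ENNReal.mul_lt_top (lintegral_exp_neg_lt_top (by linarith) _) (measure_lt_top _ _)

lemma one_le_time_of_form {n : ℕ} {η : PseudoE n} (h1 : 1 < form η η) (h2 : 0 < η.2) :
    1 ≤ η.2 := by
  rw [form_eq, real_inner_self_eq_norm_sq] at h1
  nlinarith [sq_nonneg ‖η.1‖]

/-- Because `[η, η] > 1`, normalizing `η` can only decrease its time coordinate, and `x ↦ x^{-q}` is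
decreasing. -/
lemma inv_time_rpow_le_coneLift {n : ℕ} {q : ℝ} (hq : 0 ≤ q) {η : PseudoE n}
    (h1 : 1 < form η η) (h2 : form η η < 4) (h3 : 0 < η.2) :
    (ENNReal.ofReal η.2)⁻¹ ^ q ≤ coneLift (fun x => (ENNReal.ofReal x.2)⁻¹ ^ q) η := by
  rw [coneLift, if_pos ⟨h1, h2, h3⟩]
  refine ENNReal.rpow_le_rpow (ENNReal.inv_le_inv.2 (ENNReal.ofReal_le_ofReal ?_)) hq
  rw [Prod.smul_snd, smul_eq_mul]
  have : (√(form η η))⁻¹ ≤ 1 := inv_le_one_of_one_le₀ (Real.one_le_sqrt.2 h1.le)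
  nlinarith

/-- Young's inequality bounds `Φ / y` by `Φ^p + y^{-q}` on the support of `Φ`. The second term is
dominated by the lift of `x_{k+2}^{-q}` from `ℍ^{k+1}`. At `p = 1` there is no finite conjugate
exponent, and `y ≥ 1` on the support suffices. -/
lemma lintegral_div_time_lt_top {k : ℕ} (hk : 1 ≤ k) {p : ℝ} (hp : 1 ≤ p)
    (hpk : p * ((k : ℝ) - 1) < k) {Φ : PseudoE (k + 1) → ℝ≥0∞} (hΦ : Measurable Φ)
    (hΦ0 : ∀ η, Φ η ≠ 0 → 1 < form η η ∧ form η η < 4 ∧ 0 < η.2)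
    (hfin : ∫⁻ η, Φ η ^ p < ∞) :
    ∫⁻ η, Φ η / ENNReal.ofReal η.2 < ∞ := by
  rcases hp.eq_or_lt with rfl | hp1
  · refine lt_of_le_of_lt (lintegral_mono fun η => ?_) hfin
    rw [ENNReal.rpow_one]
    by_cases h : Φ η = 0
    · simp [h]
    · obtain ⟨h1, -, h3⟩ := hΦ0 η h
      refine ENNReal.div_le_of_le_mul (le_mul_of_one_le_right zero_le ?_)
      exact ENNReal.one_le_ofReal.2 (one_le_time_of_form h1 h3)
  · have hpq := Real.HolderConjugate.conjExponent hp1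
    set q := p.conjExponent with hqdef
    have hq1 : 1 < q := hpq.symm.lt
    -- With `q = p / (p - 1)`, the inequality `k < q` is a rearrangement of `p (k - 1) < k`. This is
    -- the only place where the upper bound on `p` is needed.
    have hqk : (k : ℝ) < q := by
      rw [hqdef, Real.conjExponent, lt_div_iff₀ (by linarith)]
      linarith
    have hdiv : ∀ (a : ℝ≥0∞) {c : ℝ}, 1 < c → a / ENNReal.ofReal c ≤ a := fun a c hc =>
      ENNReal.div_le_of_le_mul (le_mul_of_one_le_right zero_le (ENNReal.one_le_ofReal.2 hc.le))
    have hGm : Measurable fun x : PseudoE (k + 1) => (ENNReal.ofReal x.2)⁻¹ ^ q := by fun_prop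
    refine lt_of_le_of_lt (b := ∫⁻ η, (Φ η ^ p +
      coneLift (fun x : PseudoE (k + 1) => (ENNReal.ofReal x.2)⁻¹ ^ q) η))
      (lintegral_mono fun η => ?_) ?_
    · by_cases h : Φ η = 0
      · simp [h]
      · obtain ⟨h1, h2, h3⟩ := hΦ0 η h
        rw [div_eq_mul_inv]
        refine (ENNReal.young_inequality _ _ hpq).trans (add_le_add (hdiv _ hp1) ?_)
        exact (hdiv _ hq1).trans (inv_time_rpow_le_coneLift (by linarith) h1 h2 h3)
    · rw [lintegral_add_left (hΦ.pow_const p), lintegral_coneLift (by omega) hGm]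
      exact ENNReal.add_lt_top.2 ⟨hfin, ENNReal.mul_lt_top (coneConst_ne_top _).lt_top
        (lintegral_hypMeasure_rpow_lt_top hqk)⟩

/-! ### The geodesics of the complex -/

/-- The part in `𝔼^{k+1,1}` of a vector of `𝔼^{n,1}`: a left inverse of `sliceIncl m k v`. -/
def sliceProj (m k : ℕ) (v : EuclideanSpace ℝ (Fin m)) :
    PseudoE (m + k) →ₗ[ℝ] PseudoE (k + 1) where
  toFun x := (consMap k (inner ℝ v (headPart m k x),
    WithLp.toLp 2 fun i => x.1 (Fin.natAdd m i)), x.2)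
  map_add' x y := by
    ext1
    · simp only [Prod.fst_add]
      rw [← map_add]
      congr 1
      ext1
      · exact inner_add_right v (headPart m k x) (headPart m k y)
      · rfl
    · rfl
  map_smul' c x := by
    ext1
    · simp only [Prod.smul_fst, RingHom.id_apply]
      rw [← map_smul]
      congr 1
      ext1
      · exact real_inner_smul_right v (headPart m k x) c
      · rfl
    · rfl

/-- `sliceIncl` as a linear map. -/
def sliceMap (m k : ℕ) (v : EuclideanSpace ℝ (Fin m)) :
    PseudoE (k + 1) →ₗ[ℝ] PseudoE (m + k) where
  toFun := sliceIncl m k v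
  map_add' x y := by
    ext1
    · simp only [sliceIncl, Prod.fst_add]
      rw [← join_add, ← add_smul]
      rfl
    · rfl
  map_smul' c x := by
    ext1
    · simp only [sliceIncl, Prod.smul_fst, RingHom.id_apply]
      rw [← join_smul, ← mul_smul]
      rfl
    · rfl

/-- `tailIncl` as a linear map. -/
def tailMap (m k : ℕ) : PseudoE k →ₗ[ℝ] PseudoE (m + k) where
  toFun := tailIncl m k
  map_add' x y := by
    ext1
    · simp only [tailIncl, Prod.fst_add]
      rw [← join_add, add_zero]
    · rfl
  map_smul' c x := by
    ext1
    · simp only [tailIncl, Prod.smul_fst, RingHom.id_apply]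
      rw [← join_smul, smul_zero]
    · rfl

lemma form_tailIncl {m k : ℕ} (z : PseudoE k) :
    form (tailIncl m k z) (tailIncl m k z) = form z z := by
  rw [form_eq, form_eq, tailIncl, inner_join, inner_zero_left, zero_add]

lemma form_sliceIncl {m k : ℕ} (v : USphere m) (η ζ : PseudoE (k + 1)) :
    form (sliceIncl m k v η) (sliceIncl m k v ζ) = form η ζ := by
  have hv : inner ℝ (v : EuclideanSpace ℝ (Fin m)) v = (1 : ℝ) := by
    rw [real_inner_self_eq_norm_sq, mem_sphere_zero_iff_norm.1 v.2, one_pow]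
  rw [form_eq, sliceIncl, sliceIncl, inner_join, inner_smul_left, inner_smul_right, hv, form,
    Fin.sum_univ_succ]
  simp only [PiLp.inner_apply, RCLike.inner_apply, conj_trivial, mul_comm (ζ.1 _)]
  ring

lemma sliceProj_sliceIncl {m k : ℕ} (v : USphere m) (η : PseudoE (k + 1)) :
    sliceProj m k v (sliceIncl m k v η) = η := by
  have hv : inner ℝ (v : EuclideanSpace ℝ (Fin m)) v = (1 : ℝ) := by
    rw [real_inner_self_eq_norm_sq, mem_sphere_zero_iff_norm.1 v.2, one_pow]
  ext1
  · change consMap k (inner ℝ (v : EuclideanSpace ℝ (Fin m)) (headPart m k (join _ _, _)), _) = _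
    rw [headPart_join, inner_smul_right, hv]
    ext i
    refine Fin.cases ?_ (fun j => ?_) i <;> simp [consMap, sliceIncl, join]
  · rfl

/-- The existential definition of the slice becomes an equation between maps continuous in `(v, x)`,
hence a measurable condition. -/
lemma mem_sliceSpace_iff {m k : ℕ} (v : USphere m) (x : PseudoE (m + k)) :
    x ∈ sliceSpace m k v ↔ sliceIncl m k v (sliceProj m k v x) = x := by
  have hform : ∀ (s : ℝ) (z : PseudoE k),
      ((join (s • (v : EuclideanSpace ℝ (Fin m))) 0, 0) : PseudoE (m + k)) + tailIncl m k z
        = sliceIncl m k v (consMap k (s, z.1), z.2) := by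
    intro s z
    ext1
    · simp only [Prod.fst_add, tailIncl, sliceIncl]
      rw [← join_add, add_zero, zero_add]
      simp [consMap]
    · simp [tailIncl, sliceIncl]
  constructor
  · rintro ⟨s, z, rfl⟩
    rw [hform, sliceProj_sliceIncl]
  · intro h
    refine ⟨headCoord k (sliceProj m k v x), tailPart k (sliceProj m k v x), ?_⟩
    rw [hform]
    nth_rewrite 1 [← h]
    congr 1

lemma continuous_sliceIncl (m k : ℕ) :
    Continuous fun q : USphere m × PseudoE (k + 1) => sliceIncl m k q.1 q.2 := by
  unfold sliceIncl
  exact (continuous_join.comp (f := fun q : USphere m × PseudoE (k + 1) =>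
    (q.2.1 0 • (q.1 : EuclideanSpace ℝ (Fin m)), WithLp.toLp 2 fun i : Fin k => q.2.1 i.succ))
    (by fun_prop)).prodMk (by fun_prop)

lemma continuous_sliceProj (m k : ℕ) :
    Continuous fun q : USphere m × PseudoE (m + k) => sliceProj m k q.1 q.2 := by
  have h : Continuous (consMap k) := LinearMap.continuous_of_finiteDimensional _
  refine Continuous.prodMk (h.comp (f := fun q : USphere m × PseudoE (m + k) =>
    (inner ℝ (q.1 : EuclideanSpace ℝ (Fin m)) (headPart m k q.2),
      WithLp.toLp 2 fun i => q.2.1 (Fin.natAdd m i))) ?_) (by fun_prop)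
  unfold headPart
  fun_prop

lemma inv_sqrt_smul_mem_hyp {n : ℕ} {Y : PseudoE n} (h : 0 < form Y Y) (h2 : 0 < Y.2) :
    (√(form Y Y))⁻¹ • Y ∈ hyp n := by
  have hs := Real.sqrt_pos.2 h
  refine ⟨?_, mul_pos (inv_pos.2 hs) h2⟩
  rw [form_smul_smul]
  nth_rewrite 3 [← Real.mul_self_sqrt h.le]
  field_simp

/-- The hyperbolic space spans the pseudo-Euclidean space. -/
lemma linearMap_ext_on_hyp {n : ℕ} {M : Type*} [AddCommGroup M] [Module ℝ M]
    {A B : PseudoE n →ₗ[ℝ] M} (h : ∀ z ∈ hyp n, A z = B z) : A = B := by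
  have hcone : ∀ Y : PseudoE n, 0 < form Y Y → 0 < Y.2 → A Y = B Y := by
    intro Y h1 h2
    have h3 := h _ (inv_sqrt_smul_mem_hyp h1 h2)
    rw [map_smul, map_smul] at h3
    exact smul_right_injective M (inv_ne_zero (Real.sqrt_pos.2 h1).ne') h3
  have he : ∀ c : ℝ, 0 < c → A (0, c) = B (0, c) := by
    intro c hc
    refine hcone _ ?_ hc
    rw [form_eq]
    simp only [inner_zero_left, sub_zero]
    exact mul_pos hc hc
  refine LinearMap.ext fun Z => ?_
  -- A sufficiently large time translation moves any `Z` into the forward cone, so `Z` is a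
  -- difference of two vectors on which the maps agree.
  have hc : 0 < ‖Z.1‖ + |Z.2| + 1 := by positivity
  have hlt : ‖Z.1‖ < Z.2 + (‖Z.1‖ + |Z.2| + 1) := by linarith [neg_abs_le Z.2]
  have hpos : 0 < Z.2 + (‖Z.1‖ + |Z.2| + 1) := (norm_nonneg _).trans_lt hlt
  have h1 : A (Z + (0, ‖Z.1‖ + |Z.2| + 1)) = B (Z + (0, ‖Z.1‖ + |Z.2| + 1)) := by
    refine hcone _ ?_ hpos
    rw [form_eq, Prod.fst_add, Prod.snd_add, add_zero, real_inner_self_eq_norm_sq]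
    nlinarith [norm_nonneg Z.1]
  rw [map_add, map_add, he _ hc] at h1
  exact add_right_cancel h1

/-- The integral over a geodesic of the complex is bounded by a hyperplane integral of the lift. -/
lemma lintegral_geodesicMeasure_le {m k : ℕ} (hm : 1 ≤ m) (hk : 1 ≤ k)
    {F : PseudoE (m + k) → ℝ≥0∞} (hF : Measurable F) {q : USphere m × PseudoE (m + k)}
    (hq : q ∈ complex m k) :
    coneConst k * ∫⁻ x, F x ∂(geodesicMeasure m k (geodesic m k q.1 q.2))
      ≤ hyperplaneIntegral (fun η => coneLift F (sliceIncl m k q.1 η))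
          (sliceProj m k q.1 q.2) := by
  -- `r` is the very rotation selected in `geodesicMeasure`. Only its defining properties are used,
  -- so the bound does not depend on the choice.
  have hex := exists_pseudoRotation hm q hq
  obtain ⟨hrot, himg⟩ := hex.choose_spec
  rw [geodesicMeasure, dif_pos hex]
  set r := hex.choose
  obtain ⟨v, w⟩ := q
  obtain ⟨hw1, hw2⟩ := hq
  simp only at hw1 hw2 himg ⊢
  have hwp : sliceIncl m k v (sliceProj m k v w) = w := (mem_sliceSpace_iff v w).1 hw2
  let R : PseudoE k →ₗ[ℝ] PseudoE (m + k) := r ∘ₗ tailMap m k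
  have hR : ∀ z, R z = r (tailIncl m k z) := fun _ => rfl
  have hRc : Measurable R := (LinearMap.continuous_of_finiteDimensional R).measurable
  have hmem : ∀ z ∈ hyp k, R z ∈ geodesic m k v w := fun z hz => by
    rw [← himg]
    exact mem_image_of_mem r (mem_image_of_mem _ hz)
  have hRform : ∀ z, form (R z) (R z) = form z z := fun z => by
    rw [hR, hrot.1, form_tailIncl]
  let T : PseudoE k →ₗ[ℝ] PseudoE (k + 1) := sliceProj m k v ∘ₗ R
  -- Being in the slice, and below being orthogonal to `w`, is known only on `ℍ^k`. Both are linear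
  -- conditions, and `ℍ^k` spans.
  have hST : ∀ Z, sliceIncl m k v (T Z) = R Z := by
    have : sliceMap m k v ∘ₗ T = R := linearMap_ext_on_hyp fun z hz =>
      (mem_sliceSpace_iff v _).1 (hmem z hz).1.2
    exact fun Z => LinearMap.congr_fun this Z
  have hRw : ∀ Z, form (R Z) w = 0 := by
    have : ((formBilin (m + k)).flip w) ∘ₗ R = 0 := linearMap_ext_on_hyp fun z hz =>
      (hmem z hz).2
    exact fun Z => LinearMap.congr_fun this Z
  have hLm : Measurable fun η => coneLift F (sliceIncl m k v η) :=
    (measurable_coneLift hF).comp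
      ((continuous_sliceIncl m k).measurable.comp measurable_prodMk_left)
  have hmap : ∫⁻ x, F x ∂(Measure.map (fun u => r (tailIncl m k u)) (hypMeasure k))
      = ∫⁻ u, F (R u) ∂(hypMeasure k) := lintegral_map hF hRc
  rw [hmap, ← lintegral_coneLift hk (F := fun u => F (R u)) (hF.comp hRc),
    hyperplaneIntegral_eq hLm ?_ T ?_ ?_]
  · refine lintegral_mono fun Z => ?_
    rw [hST]
    unfold coneLift
    split_ifs with h1 h2
    · simp only [map_smul, hRform, le_refl]
    -- `R` preserves the time direction: it maps the normalized `Z`, a point of `ℍ^k`, into the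
    -- upper sheet.
    · refine absurd ⟨by rw [hRform]; exact h1.1, by rw [hRform]; exact h1.2.1, ?_⟩ h2
      have hz := (hmem _ (inv_sqrt_smul_mem_hyp (zero_lt_one.trans h1.1) h1.2.2)).1.1.2
      rw [map_smul, Prod.smul_snd, smul_eq_mul] at hz
      exact pos_of_mul_pos_right hz (inv_nonneg.2 (Real.sqrt_nonneg _))
    · exact zero_le
    · exact le_rfl
  · rw [← form_sliceIncl v, hwp]
    exact hw1
  · intro Z
    rw [← form_sliceIncl v, hST, hRform]
  · intro Z
    rw [← form_sliceIncl v, hST, hwp, hRw]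

/-! ### Almost every geodesic of the complex -/

/-- Only absolute continuity matters: the density `cosh^{n-1} ρ` creates no new null-set conditions
beyond those for Lebesgue measure in `ρ`. -/
lemma ae_oneSheetMeasure {n : ℕ} {S : Set (PseudoE n)} (hS : MeasurableSet S)
    (h : ∀ σ : USphere n, ∀ᵐ ρ : ℝ,
      (Real.cosh ρ • (σ : EuclideanSpace ℝ (Fin n)), Real.sinh ρ) ∈ S) :
    ∀ᵐ η ∂(oneSheetMeasure n), η ∈ S := by
  have hφ : Measurable fun q : USphere n × ℝ =>
      ((Real.cosh q.2 • (q.1 : EuclideanSpace ℝ (Fin n)), Real.sinh q.2) : PseudoE n) := by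
    have : Continuous fun q : USphere n × ℝ =>
      ((Real.cosh q.2 • (q.1 : EuclideanSpace ℝ (Fin n)), Real.sinh q.2) : PseudoE n) := by fun_prop
    exact this.measurable
  refine (ae_map_iff hφ.aemeasurable hS).2 ((Measure.ae_prod_iff_ae_ae (hφ hS)).2 ?_)
  exact Filter.Eventually.of_forall fun σ => (withDensity_absolutelyContinuous _ _).ae_le (h σ)

/-- The weight is not homogeneous of degree zero. On the support of the lift, however, `[Y, Y] > 1`,
so normalizing shrinks `Y'` and only increases the weight. -/
lemma coneLift_rpow_div_le {m k : ℕ} {p : ℝ} (hp : 0 < p) (F : PseudoE (m + k) → ℝ≥0∞)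
    (Y : PseudoE (m + k)) :
    coneLift F Y ^ p / ‖headPart m k Y‖ₑ ^ (m - 1)
      ≤ coneLift (fun x => F x ^ p / ‖headPart m k x‖ₑ ^ (m - 1)) Y := by
  unfold coneLift
  split_ifs with h
  · refine ENNReal.div_le_div_left (pow_le_pow_left₀ zero_le ?_ _) _
    have h1 : headPart m k ((√(form Y Y))⁻¹ • Y) = (√(form Y Y))⁻¹ • headPart m k Y := rfl
    have h2 : (√(form Y Y))⁻¹ ≤ 1 := inv_le_one_of_one_le₀ (Real.one_le_sqrt.2 h.1.le)
    rw [h1, ← ofReal_norm, ← ofReal_norm, norm_smul,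
      Real.norm_of_nonneg (inv_nonneg.2 (Real.sqrt_nonneg _))]
    exact ENNReal.ofReal_le_ofReal (mul_le_of_le_one_left (norm_nonneg _) h2)
  · rw [ENNReal.zero_rpow_of_pos hp, ENNReal.zero_div]

/-- The theorem for nonnegative Borel functions. -/
lemma ae_lintegral_geodesicMeasure_lt_top {m k : ℕ} (hm : 1 ≤ m) (hk : 1 ≤ k)
    {p : ℝ} (hp : 1 ≤ p) (hpk : p * ((k : ℝ) - 1) < k)
    {F : PseudoE (m + k) → ℝ≥0∞} (hF : Measurable F)
    (hfin : ∫⁻ x, F x ^ p / ‖headPart m k x‖ₑ ^ (m - 1) ∂(hypMeasure (m + k)) < ∞) :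
    ∀ᵐ q ∂(complexMeasure m k),
      ∫⁻ x, F x ∂(geodesicMeasure m k (geodesic m k q.1 q.2)) < ∞ := by
  have hp0 : 0 < p := by linarith
  have hL := measurable_coneLift hF
  have hFw : Measurable fun x => F x ^ p / ‖headPart m k x‖ₑ ^ (m - 1) :=
    (hF.pow_const p).div ((measurable_headPart m k).enorm.pow_const _)
  have hincl := (continuous_sliceIncl m k).measurable
  have hproj := (continuous_sliceProj m k).measurable
  have hLp : ∫⁻ Y, coneLift F Y ^ p / ‖headPart m k Y‖ₑ ^ (m - 1) < ∞ := by
    refine (lintegral_mono (coneLift_rpow_div_le hp0 F)).trans_lt ?_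
    rw [lintegral_coneLift (by omega) hFw]
    exact ENNReal.mul_lt_top (coneConst_ne_top _).lt_top hfin
  have hslice : ∀ᵐ v : USphere m ∂(sphereMeasure m),
      ∫⁻ η, coneLift F (sliceIncl m k (v : EuclideanSpace ℝ (Fin m)) η) ^ p < ∞ := by
    refine ae_lt_top (Measurable.lintegral_prod_right' (f := fun q : USphere m × PseudoE (k + 1) =>
      coneLift F (sliceIncl m k q.1 q.2) ^ p) ((hL.comp hincl).pow_const p)) ?_
    rw [lintegral_lintegral_sliceIncl hm (Φ := fun Y => coneLift F Y ^ p) (hL.pow_const p)]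
    exact (ENNReal.mul_lt_top (by norm_num) hLp).ne
  let H : USphere m × PseudoE (m + k) → ℝ≥0∞ := fun q =>
    hyperplaneIntegral (fun η => coneLift F (sliceIncl m k q.1 η)) (sliceProj m k q.1 q.2)
  have hH : Measurable H := measurable_hyperplaneIntegral
    (Φ := fun (q : USphere m × PseudoE (m + k)) η => coneLift F (sliceIncl m k q.1 η)) (hL.comp (hincl.comp ((measurable_fst.comp measurable_fst).prodMk measurable_snd))) hproj
  -- Besides finiteness, the set records that `(v, w)` lies in the parameter space, in measurable
  -- form. This is needed to apply the geodesic bound and to transfer "almost everywhere" through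
  -- the image measure.
  let S : Set (USphere m × PseudoE (m + k)) := {q | form q.2 q.2 = -1} ∩
    ({q | sliceIncl m k q.1 (sliceProj m k q.1 q.2) = q.2} ∩ {q | H q < ∞})
  have hS : MeasurableSet S := by
    refine (measurableSet_eq_fun (measurable_form measurable_snd measurable_snd)
      measurable_const).inter ((measurableSet_eq_fun (hincl.comp (measurable_fst.prodMk hproj))
        measurable_snd).inter (measurableSet_lt hH measurable_const))
  have hφ : Measurable fun q : USphere m × PseudoE (k + 1) => (q.1, sliceIncl m k q.1 q.2) :=
    measurable_fst.prodMk hincl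
  have hae : ∀ᵐ q ∂(complexMeasure m k), q ∈ S := by
    have : SFinite (oneSheetMeasure (k + 1)) := by
      unfold oneSheetMeasure
      infer_instance
    refine (ae_map_iff hφ.aemeasurable hS).2 ((Measure.ae_prod_iff_ae_ae (hφ hS)).2 ?_)
    filter_upwards [hslice] with v hv
    refine ae_oneSheetMeasure (S := {η | (v, sliceIncl m k v η) ∈ S})
      ((hφ.comp measurable_prodMk_left) hS) fun σ => ?_
    have hΦ : Measurable fun η => coneLift F (sliceIncl m k (v : EuclideanSpace ℝ (Fin m)) η) :=
      hL.comp (hincl.comp measurable_prodMk_left)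
    have htime := lintegral_div_time_lt_top hk hp hpk hΦ (fun η hη => by
      by_contra h
      refine hη (if_neg ?_)
      rwa [form_sliceIncl v]) hv
    have hσ := (lintegral_hyperplaneIntegral_le hΦ
      (fun η hη => coneLift_eq_zero F (Or.inl hη)) σ).trans_lt htime
    have hcurve : Measurable fun ρ : ℝ =>
        ((Real.cosh ρ • (σ : EuclideanSpace ℝ (Fin (k + 1))), Real.sinh ρ) : PseudoE (k + 1)) := by
      fun_prop
    have hmeas : Measurable fun ρ : ℝ => (ENNReal.ofReal (Real.cosh ρ))⁻¹ *
        hyperplaneIntegral (fun η => coneLift F (sliceIncl m k v η))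
          (Real.cosh ρ • (σ : EuclideanSpace ℝ (Fin (k + 1))), Real.sinh ρ) := by
      refine Measurable.mul (by fun_prop) (measurable_hyperplaneIntegral
        (Φ := fun (_ : ℝ) η => coneLift F (sliceIncl m k v η)) (hΦ.comp measurable_snd) hcurve)
    filter_upwards [ae_lt_top hmeas hσ.ne] with ρ hρ
    refine ⟨?_, ?_, ?_⟩
    · change form (sliceIncl m k v _) (sliceIncl m k v _) = -1
      rw [form_sliceIncl v, form_eq, inner_smul_left, inner_smul_right, real_inner_self_eq_norm_sq,
        mem_sphere_zero_iff_norm.1 σ.2, conj_trivial]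
      linear_combination -Real.cosh_sq ρ
    · change sliceIncl m k v (sliceProj m k v (sliceIncl m k v _)) = sliceIncl m k v _
      rw [sliceProj_sliceIncl v]
    · change hyperplaneIntegral _ (sliceProj m k v (sliceIncl m k v _)) < ∞
      rw [sliceProj_sliceIncl v]
      -- The factor `(cosh ρ)⁻¹` is nonzero, so finiteness of the product gives finiteness of the
      -- hyperplane integral.
      rcases ENNReal.mul_lt_top_iff.1 hρ with h | h | h
      · exact h.2
      · exact absurd h (ENNReal.inv_ne_zero.2 ENNReal.ofReal_ne_top)
      · rw [h]
        exact ENNReal.zero_lt_top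
  filter_upwards [hae] with q hq
  have hle := (lintegral_geodesicMeasure_le hm hk hF (q := q)
    ⟨hq.1, (mem_sliceSpace_iff q.1 q.2).2 hq.2.1⟩).trans_lt hq.2.2
  rcases ENNReal.mul_lt_top_iff.1 hle with h | h | h
  · exact h.2
  · exact absurd h (coneConst_ne_zero k)
  · rw [h]
    exact ENNReal.zero_lt_top

end HypRadon

end

/-! ### Passage from Borel functions to functions measurable up to null sets -/

theorem mainTheorem5 {𝕜 : Type*} [RCLike 𝕜] (m k : ℕ) (hm : 1 ≤ m) (hk : 1 ≤ k)
    (p : ℝ) (hp : 1 ≤ p) (hpk : p * ((k : ℝ) - 1) < k)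
    (f : HypRadon.PseudoE (m + k) → 𝕜)
    (hf : AEStronglyMeasurable f (HypRadon.hypMeasure (m + k)))
    (hfp : ∫⁻ x, ‖f x‖ₑ ^ p / ‖HypRadon.headPart m k x‖ₑ ^ (m - 1)
      ∂(HypRadon.hypMeasure (m + k)) < ∞) :
    ∀ᵐ q ∂(HypRadon.complexMeasure m k),
      HypRadon.RestrictedTransformFinite m k f q.1 q.2 := by
  let N := toMeasurable (HypRadon.hypMeasure (m + k)) {x | ¬ f x = hf.mk f x}
  have hN : MeasurableSet N := measurableSet_toMeasurable _ _
  have hN0 : HypRadon.hypMeasure (m + k) N = 0 := by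
    rw [measure_toMeasurable]
    exact ae_iff.1 hf.ae_eq_mk
  have hNf : ∀ x, x ∉ N → f x = hf.mk f x := fun x hx => by
    by_contra h
    exact hx (subset_toMeasurable _ _ h)
  -- A null set of hyperbolic space could a priori fill a single geodesic. The value `∞` on the null
  -- set `N` does not change the weighted norm, yet it makes finiteness of the geodesic integral
  -- control `N` as well.
  let F : HypRadon.PseudoE (m + k) → ℝ≥0∞ := fun x =>
    ‖hf.mk f x‖ₑ + N.indicator (fun _ => ∞) x
  have hF : Measurable F :=
    hf.stronglyMeasurable_mk.enorm.add (measurable_const.indicator hN)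
  have hFf : ∀ x, x ∉ N → F x = ‖f x‖ₑ := fun x hx => by
    simp only [F]
    rw [indicator_of_notMem hx, add_zero, hNf x hx]
  have hfin : ∫⁻ x, F x ^ p / ‖HypRadon.headPart m k x‖ₑ ^ (m - 1)
      ∂(HypRadon.hypMeasure (m + k)) < ∞ := by
    refine lt_of_eq_of_lt (lintegral_congr_ae ?_) hfp
    filter_upwards [measure_eq_zero_iff_ae_notMem.1 hN0] with x hx
    rw [hFf x hx]
  filter_upwards [HypRadon.ae_lintegral_geodesicMeasure_lt_top hm hk hp hpk hF hfin] with q hq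
  -- A finite integral of `F` forces `N` to be null on this geodesic. There `f` agrees almost
  -- everywhere with its Borel version, which also gives the measurability required for
  -- integrability.
  have hnot : ∀ᵐ x ∂(HypRadon.geodesicMeasure m k (HypRadon.geodesic m k q.1 q.2)), x ∉ N := by
    filter_upwards [ae_lt_top hF hq.ne] with x hx hxN
    simp only [F] at hx
    rw [indicator_of_mem hxN, add_top] at hx
    exact lt_irrefl _ hx
  refine ⟨⟨hf.mk f, hf.stronglyMeasurable_mk, hnot.mono hNf⟩, ?_⟩
  refine lt_of_eq_of_lt (lintegral_congr_ae ?_) hq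
  exact hnot.mono fun x hx => (hFf x hx).symm
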